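/- Let $\Gamma$ be a group generated by a finite, nonempty, symmetric set $S\subseteq\Gamma\setminus\{1\}$, let $c:S\to\mathbb{R}_{>0}$ satisfy $c(s)=c(s^{-1})$, and let $(G,c)$ be the weighted Cayley graph: $V(G)=\Gamma$, $E(G)=\{\{x,y\}: y^{-1}x\in S\}$, $c\{x,y\}=c(y^{-1}x)$. Put $\mu_x(y)=c\{x,y\}/\sum_{z\sim x}c\{x,z\}$ for $y\sim x$. **Wired spanning forest.** For a finite connected network $(H,c)$ and a vertex $r$, an $r$-oriented spanning tree is an oriented subgraph in which every vertex has exactly one directed walk to $r$; let $\overrightarrow{\mathsf{WSF}}_r(H,c)$ be the probability measure on $r$-oriented spanning trees $T$ proportional to $\prod_{(x,y)\in T}c\{x,y\}$. For finite connected sets $W_0\subseteq W_1\subseteq\cdots$ of vertices of $G$ with union $\Gamma$, let $(G_n,c_n)$ be obtained from $(G,c)$ by identifying all vertices outside $W_n$ to one vertex, deleting loops and merging parallel edges by adding their conductances. The law $\overrightarrow{\mathsf{WSF}}_r=\overrightarrow{\mathsf{WSF}}_r(G,c)$ is the probability measure on oriented subgraphs $F$ of $G$ such that, for every such exhaustion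 $(W_n)$ and every finite set $B$ of oriented edges, $$\overrightarrow{\mathsf{WSF}}_r[B\subseteq F]=\lim_{n\to\infty}\overrightarrow{\mathsf{WSF}}_r(G_n,c_n)[B\subseteq T_n].$$ The law $\overrightarrow{\mathsf{WSF}}{}^+_r$ is the law of $F\sqcup\{(r,Y)\}$, where $F$ has law $\overrightarrow{\mathsf{WSF}}_r$ and $Y$ is independent of $F$ with law $\mu_r$. A rotor configuration is a map $\rho:\Gamma\to\Gamma$ with $\rho(x)\sim x$ for all $x$; it is identified with the oriented subgraph $\{(x,\rho(x)):x\in\Gamma\}$. **Walk.** A mechanism is a family of transition probabilities $p_x(\cdot,\cdot)$ on the set of neighbors of $x$, one for each $x\in\Gamma$. It is transitive if $\mu_x$ is stationary for $p_x$ for every $x$, and $p_x(y,y')=p_{gx}(gy,gy')$ for all $x,g\in\Gamma$ and all neighbors $y,y'$ of $x$. A random walk with local memory is a random sequence $(X_n,\rho_n)_{n\ge0}$ of vertices and rotor configurations such that, given the past up to time $n$, $X_{n+1}$ is sampled from $p_{X_n}(\rho_n(X_n),\cdot)$, and $\rho_{n+1}(X_n)=X_{n+1}$, $\rho_{n+1}(x)=\rho_n(x)$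 for $x\ne X_n$. Its scenery process is $\hat\rho_n(x)=X_n^{-1}\rho_n(X_nx)$. A probability law $\pi$ on rotor configurations is a native environment for the mechanism if, for every such walk with $X_0=1$ and $\rho_0\sim\pi$, the scenery process is stationary: $(\hat\rho_n)_{n\ge0}\overset{d}{=}(\hat\rho_{n+1})_{n\ge0}$. **Theorem.** The law $\overrightarrow{\mathsf{WSF}}_1(G,c)$ exists and is unique; $\overrightarrow{\mathsf{WSF}}{}^+_1(G,c)$ is the law of a (unique in law) random rotor configuration; and $\overrightarrow{\mathsf{WSF}}{}^+_1(G,c)$ is a native environment for every transitive mechanism on $(G,c)$. -/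

import Mathlib

open MeasureTheory ProbabilityTheory Filter Topology

universe u w

noncomputable section

/-! ## Electrical networks -/

/-- A locally finite, simple, connected graph with positive conductances on its edges.
The conductance `c x y` of the unoriented edge `{x, y}` is symmetric; the values of `c` at pairs
which are not edges play no role. -/
structure ElectricalNetwork (V : Type u) where
  graph : SimpleGraph V
  locallyFinite : ∀ x, (graph.neighborSet x).Finite
  connected : graph.Connected
  c : V → V → ℝ
  c_symm : ∀ x y, graph.Adj x y → c x y = c y x
  c_pos : ∀ x y, graph.Adj x y → 0 < c x y

namespace ElectricalNetwork

/-- `T` is an `r`-oriented spanning tree of `G`: from every vertex there is exactly one directed walk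
in `T` that ends at `r`. An oriented subgraph is given by its set of oriented edges (`G.Dart`).
Walks (which may a priori repeat vertices) are used so that `r` has outdegree `0` in `T`. -/
def IsOrientedSpanningTree {U : Type u} (G : SimpleGraph U) (r : U) (T : Set G.Dart) : Prop :=
  ∀ x, ∃! p : G.Walk x r, ∀ d ∈ p.darts, d ∈ T

/-- The weight of an oriented subgraph: the product of the conductances of its edges. -/
def weight {U : Type u} (N : ElectricalNetwork U) (T : Set N.graph.Dart) : ℝ :=
  ∏ᶠ d ∈ T, N.c d.fst d.snd

/-- The measure that gives mass `weight T` to every `r`-oriented spanning tree `T`. -/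
def treeMeasure {U : Type u} (N : ElectricalNetwork U) (r : U) : Measure (Set N.graph.Dart) :=
  Measure.sum fun T : {T : Set N.graph.Dart // IsOrientedSpanningTree N.graph r T} =>
    ENNReal.ofReal (N.weight T.1) • Measure.dirac T.1

/-- The `r`-oriented wired spanning forest of a finite network: the probability measure
on `r`-oriented spanning trees with probabilities proportional to the weights. -/
def finiteOrientedWSF {U : Type u} (N : ElectricalNetwork U) (r : U) :
    Measure (Set N.graph.Dart) :=
  (N.treeMeasure r Set.univ)⁻¹ • N.treeMeasure r

/-! ### Wired exhaustions -/

/-- Two vertices are identified if they are equal or if both are outside `W`. -/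
def wiredSetoid {V : Type u} (W : Finset V) : Setoid V where
  r x y := x = y ∨ (x ∉ W ∧ y ∉ W)
  iseqv := by
    refine ⟨fun x => Or.inl rfl, ?_, ?_⟩
    · rintro x y (h | h)
      · exact Or.inl h.symm
      · exact Or.inr h.symm
    · rintro x y z (rfl | h) (rfl | h')
      · exact Or.inl rfl
      · exact Or.inr h'
      · exact Or.inr h
      · exact Or.inr ⟨h.1, h'.2⟩

/-- The vertices of the wired graph: those of `W`, and one further vertex if `W` is not all of `V`. -/
abbrev WiredVertex {V : Type u} (W : Finset V) : Type u := Quotient (wiredSetoid W)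

/-- The projection that identifies all the vertices outside `W`. -/
def wiredMk {V : Type u} (W : Finset V) (x : V) : WiredVertex W := Quotient.mk (wiredSetoid W) x

lemma wiredMk_eq_iff {V : Type u} {W : Finset V} {x y : V} :
    wiredMk W x = wiredMk W y ↔ x = y ∨ (x ∉ W ∧ y ∉ W) :=
  Quotient.eq (r := wiredSetoid W)

instance {V : Type u} (W : Finset V) : Finite (WiredVertex W) := by
  classical
  by_cases h : ∃ z, z ∉ W
  · obtain ⟨z, hz⟩ := h
    refine Finite.of_surjective
      (fun o : Option W => o.elim (wiredMk W z) (fun x => wiredMk W x.1)) ?_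
    intro q
    obtain ⟨x, rfl⟩ := Quotient.exists_rep q
    by_cases hx : x ∈ W
    · exact ⟨some ⟨x, hx⟩, rfl⟩
    · exact ⟨none, wiredMk_eq_iff.2 (Or.inr ⟨hz, hx⟩)⟩
  · push Not at h
    refine Finite.of_surjective (fun x : W => wiredMk W x.1) ?_
    intro q
    obtain ⟨x, rfl⟩ := Quotient.exists_rep q
    exact ⟨⟨x, h x⟩, rfl⟩

/-- The graph obtained by identifying all the vertices outside `W`, with loops and extra multiple
edges removed. -/
def wiredGraph {V : Type u} (G : SimpleGraph V) (W : Finset V) : SimpleGraph (WiredVertex W) where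
  Adj a b := a ≠ b ∧ ∃ x y, G.Adj x y ∧ wiredMk W x = a ∧ wiredMk W y = b
  symm := ⟨fun _ _ h => ⟨h.1.symm, by
    obtain ⟨-, x, y, hxy, hx, hy⟩ := h
    exact ⟨y, x, hxy.symm, hy, hx⟩⟩⟩
  loopless := ⟨fun _ h => h.1 rfl⟩

/-- The oriented edges of `G` that go from the class `a` to the class `b`. -/
def dartsBetween {V : Type u} (G : SimpleGraph V) (W : Finset V) (a b : WiredVertex W) :
    Set G.Dart :=
  {d | wiredMk W d.fst = a ∧ wiredMk W d.snd = b}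

lemma finite_dartsBetween {V : Type u} (N : ElectricalNetwork V) (W : Finset V)
    {a b : WiredVertex W} (hab : a ≠ b) : (dartsBetween N.graph W a b).Finite := by
  classical
  have h1 : (⋃ x ∈ W, ⋃ y ∈ N.graph.neighborSet x, ({(x, y), (y, x)} : Set (V × V))).Finite :=
    W.finite_toSet.biUnion fun x _ => (N.locallyFinite x).biUnion fun y _ => Set.toFinite _
  refine Set.Finite.of_finite_image (f := fun d : N.graph.Dart => d.toProd)
    (h1.subset ?_) (fun d _ e _ h => SimpleGraph.Dart.ext _ _ h)
  rintro _ ⟨d, ⟨ha, hb⟩, rfl⟩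
  simp only [Set.mem_iUnion]
  by_cases hx : d.fst ∈ W
  · exact ⟨d.fst, hx, d.snd, d.adj, Or.inl rfl⟩
  · by_cases hy : d.snd ∈ W
    · exact ⟨d.snd, hy, d.fst, d.adj.symm, Or.inr rfl⟩
    · exact absurd (ha.symm.trans ((wiredMk_eq_iff.2 (Or.inr ⟨hx, hy⟩)).trans hb)) hab

/-- The network obtained from `N` by identifying all the vertices outside the finite set `W` to a
single vertex. The conductance of an edge is the sum of the conductances of the edges of `N`
that are merged into it. -/
def wired {V : Type u} (N : ElectricalNetwork V) (W : Finset V) :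
    ElectricalNetwork (WiredVertex W) where
  graph := wiredGraph N.graph W
  locallyFinite _ := Set.toFinite _
  connected := by
    have hne : Nonempty (WiredVertex W) := N.connected.nonempty.map (wiredMk W)
    refine SimpleGraph.Connected.mk (fun a b => ?_)
    obtain ⟨x, rfl⟩ := Quotient.exists_rep a
    obtain ⟨y, rfl⟩ := Quotient.exists_rep b
    obtain ⟨p⟩ := N.connected.preconnected x y
    induction p with
    | nil => exact SimpleGraph.Reachable.refl _
    | @cons x y z h p ih =>
      refine SimpleGraph.Reachable.trans ?_ ih
      by_cases he : wiredMk W x = wiredMk W y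
      · exact (congrArg (fun t => (wiredGraph N.graph W).Reachable (wiredMk W x) t) he).mp
          (SimpleGraph.Reachable.refl _)
      · exact SimpleGraph.Adj.reachable ⟨he, x, y, h, rfl, rfl⟩
  c a b := ∑ᶠ d ∈ dartsBetween N.graph W a b, N.c d.fst d.snd
  c_symm a b _ := by
    refine finsum_mem_eq_of_bijOn SimpleGraph.Dart.symm ⟨?_, ?_, ?_⟩ ?_
    · rintro d ⟨ha, hb⟩
      exact ⟨hb, ha⟩
    · exact fun d _ e _ h => SimpleGraph.Dart.symm_involutive.injective h
    · rintro d ⟨hb, ha⟩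
      exact ⟨d.symm, ⟨ha, hb⟩, SimpleGraph.Dart.symm_symm d⟩
    · exact fun d _ => N.c_symm _ _ d.adj
  c_pos a b h := by
    obtain ⟨hab, x, y, hxy, hx, hy⟩ := h
    exact finsum_cond_pos (fun d _ => (N.c_pos _ _ d.adj).le)
      ⟨⟨(x, y), hxy⟩, ⟨hx, hy⟩, N.c_pos _ _ hxy⟩
      ((finite_dartsBetween N W hab).subset fun d hd => hd.2)

/-- An increasing sequence of finite connected sets of vertices with union `V`. -/
def IsExhaustion {V : Type u} (N : ElectricalNetwork V) (W : ℕ → Finset V) : Prop :=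
  (∀ n, (N.graph.induce (W n : Set V)).Connected) ∧ (∀ n, W n ⊆ W (n + 1)) ∧ ∀ x, ∃ n, x ∈ W n

/-- The event that the oriented subgraph `T` of the wired graph contains (the images of) all the
oriented edges in `B`. If `W` contains the end points of the edges in `B`, this is `B ⊆ T`. -/
def containsEdges {V : Type u} (N : ElectricalNetwork V) (W : Finset V)
    (B : Finset N.graph.Dart) : Set (Set (N.wired W).graph.Dart) :=
  {T | ∀ d ∈ B, ∃ e ∈ T, e.fst = wiredMk W d.fst ∧ e.snd = wiredMk W d.snd}

/-- `ν` is the law of the `r`-oriented wired spanning forest of `N`: a probability measure on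
oriented subgraphs with `ν[B ⊆ F] = lim μ_{r,n}[B ⊆ T_n]` for every wired exhaustion and every finite
set `B` of oriented edges. -/
def IsOrientedWSF {V : Type u} (N : ElectricalNetwork V) (r : V)
    (ν : Measure (Set N.graph.Dart)) : Prop :=
  IsProbabilityMeasure ν ∧
    ∀ W : ℕ → Finset V, N.IsExhaustion W → ∀ B : Finset N.graph.Dart,
      Tendsto (fun n => (N.wired (W n)).finiteOrientedWSF (wiredMk (W n) r)
          (N.containsEdges (W n) B))
        atTop (𝓝 (ν {F | (B : Set N.graph.Dart) ⊆ F}))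

/-- `μ_x(y) = c{x,y} / ∑_{z ∼ x} c{x,z}`. -/
def mu {V : Type u} (N : ElectricalNetwork V) (x : V) (y : N.graph.neighborSet x) : ℝ :=
  N.c x y / ∑ᶠ z : N.graph.neighborSet x, N.c x z

/-- `μ_x` as a measure on the neighbors of `x`. -/
def muMeasure {V : Type u} [MeasurableSpace V] (N : ElectricalNetwork V) (x : V) :
    Measure (N.graph.neighborSet x) :=
  Measure.sum fun y => ENNReal.ofReal (N.mu x y) • Measure.dirac y

/-- The law of `F ⊔ {(r, Y)}`, where `F` has law `ν` and `Y` is an independent random neighbor of `r`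
with law `μ_r`. -/
def plusEdge {V : Type u} [MeasurableSpace V] (N : ElectricalNetwork V) (r : V)
    (ν : Measure (Set N.graph.Dart)) : Measure (Set N.graph.Dart) :=
  (ν.prod (N.muMeasure r)).map fun q => insert ⟨(r, q.2.1), q.2.2⟩ q.1

end ElectricalNetwork

/-! ## Random walks with local memory -/

/-- A rotor configuration: every vertex is assigned one of its neighbors. -/
abbrev RotorConfig {V : Type u} (G : SimpleGraph V) : Type u := (x : V) → G.neighborSet x

/-- The oriented subgraph with edge set `{(x, ρ x) | x ∈ V}`. -/
def RotorConfig.toSubgraph {V : Type u} {G : SimpleGraph V} (ρ : RotorConfig G) : Set G.Dart :=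
  {d | d.snd = ρ d.fst}

/-- A mechanism: for every vertex `x` a Markov chain on the set of neighbors of `x`, given by its
transition probabilities `p x y y'`. -/
abbrev Mechanism {V : Type u} (G : SimpleGraph V) : Type u :=
  (x : V) → G.neighborSet x → PMF (G.neighborSet x)

/-- The `σ`-algebra generated by `(X_k, ρ_k)`, `k ≤ n`. -/
abbrev walkPast {V : Type u} [MeasurableSpace V] {G : SimpleGraph V} {Ω : Type w}
    (X : ℕ → Ω → V) (ρ : ℕ → Ω → RotorConfig G) (n : ℕ) : MeasurableSpace Ω :=
  ⨆ k ≤ n, MeasurableSpace.comap (fun ω => (X k ω, ρ k ω)) inferInstance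

/-- `(X_n, ρ_n)` is a random walk with local memory with mechanism `p`: given the past up to time `n`,
the next location `X_{n+1}` is a neighbor of `X_n` sampled from `p_{X_n}(ρ_n(X_n), ·)`;
`ρ_{n+1}` differs from `ρ_n` only at `X_n`, where it is equal to `X_{n+1}`. -/
structure IsRWLM {V : Type u} [MeasurableSpace V] {G : SimpleGraph V} (p : Mechanism G)
    {Ω : Type w} [MeasurableSpace Ω] (P : Measure Ω)
    (X : ℕ → Ω → V) (ρ : ℕ → Ω → RotorConfig G) : Prop where
  measurable_location : ∀ n, Measurable (X n)
  measurable_rotor : ∀ n, Measurable (ρ n)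
  rotor_update : ∀ n, ∀ᵐ ω ∂P, (ρ (n + 1) ω (X n ω) : V) = X (n + 1) ω ∧
    ∀ x, x ≠ X n ω → ρ (n + 1) ω x = ρ n ω x
  transition : ∀ n (A : Set Ω), MeasurableSet[walkPast X ρ n] A →
    ∀ (x : V) (y y' : G.neighborSet x),
      P (A ∩ {ω | X n ω = x ∧ ρ n ω x = y} ∩ {ω | X (n + 1) ω = y'}) =
        P (A ∩ {ω | X n ω = x ∧ ρ n ω x = y}) * p x y y'

/-! ## Weighted Cayley graphs -/

/-- A weighted Cayley graph: a finite symmetric generating set `S` without the identity, and positive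
weights on `S` with `c s = c s⁻¹` (values of `c` outside `S` play no role). -/
structure WeightedCayleyGraph (Γ : Type u) [Group Γ] where
  S : Finset Γ
  one_notMem : (1 : Γ) ∉ S
  inv_mem : ∀ s ∈ S, s⁻¹ ∈ S
  generates : Subgroup.closure (S : Set Γ) = ⊤
  c : Γ → ℝ
  c_pos : ∀ s ∈ S, 0 < c s
  c_inv : ∀ s ∈ S, c s⁻¹ = c s

namespace WeightedCayleyGraph

variable {Γ : Type u} [Group Γ]

/-- The Cayley graph. -/
abbrev graph (C : WeightedCayleyGraph Γ) : SimpleGraph Γ := SimpleGraph.mulCayley (C.S : Set Γ)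

lemma adj_iff (C : WeightedCayleyGraph Γ) {x y : Γ} : C.graph.Adj x y ↔ y⁻¹ * x ∈ C.S := by
  have hinv : ∀ {a b : Γ}, a⁻¹ * b ∈ C.S → b⁻¹ * a ∈ C.S := fun {a b} h => by
    simpa using C.inv_mem _ h
  rw [SimpleGraph.mulCayley_adj]
  constructor
  · rintro ⟨-, h | h⟩
    · exact hinv h
    · exact h
  · intro h
    refine ⟨?_, Or.inr h⟩
    rintro rfl
    exact C.one_notMem (by simpa using h)

lemma adj_mul_left (C : WeightedCayleyGraph Γ) (g : Γ) {x y : Γ} (h : C.graph.Adj x y) :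
    C.graph.Adj (g * x) (g * y) := by
  rw [adj_iff] at h ⊢
  simpa [mul_assoc] using h

lemma connected (C : WeightedCayleyGraph Γ) : C.graph.Connected := by
  have h1 : ∀ g : Γ, C.graph.Reachable 1 g := by
    intro g
    have hg : g ∈ Subgroup.closure (C.S : Set Γ) := by rw [C.generates]; trivial
    have hs : ∀ (x s : Γ), s ∈ C.S → C.graph.Reachable x (x * s) := fun x s h =>
      SimpleGraph.Adj.reachable (SimpleGraph.Adj.symm (C.adj_iff.2 (by simpa using h)))
    induction hg using Subgroup.closure_induction_right with
    | one => exact SimpleGraph.Reachable.refl _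
    | mul_right x _ y hy ih => exact ih.trans (hs x y hy)
    | mul_inv_cancel x _ y hy ih => exact ih.trans (hs x _ (C.inv_mem y hy))
  exact SimpleGraph.Connected.mk (fun a b => (h1 a).symm.trans (h1 b))

/-- The electrical network with conductances `c{x,y} = c(y⁻¹x)`. -/
def network (C : WeightedCayleyGraph Γ) : ElectricalNetwork Γ where
  graph := C.graph
  locallyFinite x := by
    refine (C.S.finite_toSet.image (fun s => x * s⁻¹)).subset fun y hy => ?_
    exact ⟨y⁻¹ * x, C.adj_iff.1 hy, by simp⟩
  connected := C.connected
  c x y := C.c (y⁻¹ * x)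
  c_symm x y h := by
    rw [← C.c_inv _ (C.adj_iff.1 h)]
    simp
  c_pos x y h := C.c_pos _ (C.adj_iff.1 h)

/-- Left multiplication by `g`, as a map from the neighbors of `x` to those of `g x`. -/
def smulNbr (C : WeightedCayleyGraph Γ) (g : Γ) {x : Γ} (y : C.network.graph.neighborSet x) :
    C.network.graph.neighborSet (g * x) :=
  ⟨g * y, C.adj_mul_left g y.2⟩

/-- A transitive mechanism: every `μ_x` is a stationary distribution of the local chain at `x`, and
the transition probabilities are invariant under left multiplication. -/
def IsTransitive (C : WeightedCayleyGraph Γ) (p : Mechanism C.network.graph) : Prop :=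
  (∀ (x : Γ) (y' : C.network.graph.neighborSet x),
      ∑' y, ENNReal.ofReal (C.network.mu x y) * p x y y' = ENNReal.ofReal (C.network.mu x y')) ∧
    ∀ (x g : Γ) (y y' : C.network.graph.neighborSet x),
      p x y y' = p (g * x) (C.smulNbr g y) (C.smulNbr g y')

/-- The rotor configuration `x ↦ g⁻¹ ρ(g x)`: the configuration `ρ` as seen from `g`. -/
def viewFrom (C : WeightedCayleyGraph Γ) (g : Γ) (ρ : RotorConfig C.network.graph) :
    RotorConfig C.network.graph :=
  fun x => ⟨g⁻¹ * ρ (g * x), by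
    have h := C.adj_mul_left g⁻¹ (ρ (g * x)).2
    rwa [inv_mul_cancel_left] at h⟩

/-- `π` is a native environment for the mechanism `p`: for every random walk with local memory with
mechanism `p` that starts at the identity with an initial rotor configuration of law `π`,
the scenery process `ρ̂_n(x) = X_n⁻¹ ρ_n(X_n x)` is stationary: the sequences `(ρ̂_n)` and
`(ρ̂_{n+1})` have the same law. -/
def IsNativeEnvironment [MeasurableSpace Γ] (C : WeightedCayleyGraph Γ)
    (p : Mechanism C.network.graph) (π : Measure (RotorConfig C.network.graph)) : Prop :=
  ∀ (Ω : Type w) [MeasurableSpace Ω] (P : Measure Ω) [IsProbabilityMeasure P]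
    (X : ℕ → Ω → Γ) (ρ : ℕ → Ω → RotorConfig C.network.graph),
    IsRWLM p P X ρ → (∀ᵐ ω ∂P, X 0 ω = 1) → P.map (ρ 0) = π →
      IdentDistrib (fun ω (n : ℕ) => C.viewFrom (X n ω) (ρ n ω))
        (fun ω (n : ℕ) => C.viewFrom (X (n + 1) ω) (ρ (n + 1) ω)) P P

/-- `π` is the law of the `r`-oriented wired spanning forest plus one edge, as a law on rotor
configurations; `ν` is the law of the `r`-oriented wired spanning forest. -/
def IsPlusLaw [MeasurableSpace Γ] (C : WeightedCayleyGraph Γ) (r : Γ)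
    (ν : Measure (Set C.network.graph.Dart)) (π : Measure (RotorConfig C.network.graph)) : Prop :=
  π.map RotorConfig.toSubgraph = C.network.plusEdge r ν

end WeightedCayleyGraph

end

/-! Existence. In a finite network, let `treeSum w r` be the determinant of the Laplacian of
directed weights `w` grounded at `r`. By the matrix-tree theorem (`treeSum_eq_sum`) it counts
weighted trees oriented towards `r`. The event that the tree contains prescribed edges is encoded by
deleting every competing transition out of their sources (`restrictTo`), so its probability is a
ratio of two tree sums. The two Laplacians differ only in the rows of those sources. Multiplying by
the Green function of the walk killed at `r` therefore turns the ratio into a determinant of fixed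
size whose entries are differences of Green function values (`IsConductance.treeSum_eq_mul_det`). By
polarization, Green function values are combinations of energies of charges. Such an energy is a
supremum over test functions (`IsConductance.le_chargeEnergy`). It can only grow when the wired set
grows, because functions pull back to a finer wired graph with the same energy. A fixed path from
each charge to `r` bounds it uniformly. Hence all inclusion probabilities converge along the
directed set of finite vertex sets, and so along every exhaustion. Inclusion events of finite sets
determine a law, and a law with the limiting values exists by compactness of the probability
measures on a product of two-point spaces.

Stationarity. The Markov chain tree theorem (`sum_treeSum_mul`) says that `∑ y, T y * w y x = T x *
∑ y, w x y` for the tree sums `T`; it holds for the restricted weights too. For symmetric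
conductances the unrestricted tree sum, which normalizes the ratios, does not depend on the root, so
the identity passes to the limit (`sum_treeRatio_mul`). On a Cayley graph the root can be translated
back to the identity (`sum_treeRatio_translate`). Under the forest plus one edge, the rotor at the
identity has law `μ_1` and is independent of the other rotors. A transitive mechanism replaces it by
a new rotor that again has law `μ_1` and is independent of the others. Moving along this rotor and
recentering changes cylinder probabilities exactly as in the translated identity, so the law is
preserved (`IsPlusLaw.sum_map_step`). The scenery process is Markov with this one-step transition,
so an invariant initial law makes it stationary. -/

noncomputable section

/-! ### Directed Laplacians, the matrix-tree theorem and the Markov chain tree theorem. -/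

namespace DirectedLaplacian

variable {U : Type*} [Fintype U] [DecidableEq U]

/-- The Laplacian of the directed weights `w`. -/
def laplacian (w : U → U → ℝ) : Matrix U U ℝ :=
  Matrix.of fun v => ∑ y, w v y • (Pi.single v 1 - Pi.single y 1)

/-- The Laplacian with the row of `r` replaced by a unit vector. -/
def grounded (w : U → U → ℝ) (r : U) : Matrix U U ℝ :=
  (laplacian w).updateRow r (Pi.single r 1)

/-- The determinant of the grounded Laplacian; it is the generating function of the trees
oriented towards `r`. -/
def treeSum (w : U → U → ℝ) (r : U) : ℝ := (grounded w r).det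

/-- The map that sends each vertex to its parent in a tree oriented towards `r`, and `r` to `r`. -/
def IsTreeMap (r : U) (ρ : U → U) : Prop := ρ r = r ∧ ∀ v, ∃ n, ρ^[n] v = r

lemma laplacian_mulVec (w : U → U → ℝ) (f : U → ℝ) (v : U) :
    (laplacian w).mulVec f v = ∑ y, w v y * (f v - f y) := by
  simp only [Matrix.mulVec, laplacian, Matrix.of_apply, sum_dotProduct, smul_dotProduct,
    sub_dotProduct, single_one_dotProduct, smul_eq_mul]

lemma laplacian_apply (w : U → U → ℝ) (v x : U) :
    laplacian w v x = (if v = x then ∑ y, w x y else 0) - w v x := by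
  simp only [laplacian, Matrix.of_apply, Finset.sum_apply, Pi.smul_apply, Pi.sub_apply,
    smul_eq_mul, mul_sub, Finset.sum_sub_distrib, Pi.single_apply]
  congr 1
  · rcases eq_or_ne v x with rfl | h
    · simp
    · simp [h, h.symm]
  · simp

/-- Ordered by the number of steps that `ρ` needs to reach `r`, the matrix is block triangular,
since `ρ` lowers this number; the diagonal blocks are identity matrices. -/
lemma det_treeMatrix {r : U} {ρ : U → U} (h : ∀ v, ∃ n, ρ^[n] v = r) :
    (Matrix.of fun v : U => if v = r then (Pi.single r 1 : U → ℝ)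
      else Pi.single v 1 - Pi.single (ρ v) 1).det = 1 := by
  set M := Matrix.of fun v : U => if v = r then (Pi.single r 1 : U → ℝ)
      else Pi.single v 1 - Pi.single (ρ v) 1 with hM
  let d : U → ℕ := fun v => Nat.find (h v)
  have hd : ∀ v, v ≠ r → d (ρ v) < d v := by
    intro v hv
    have h0 : d v ≠ 0 := by
      intro h0
      have := Nat.find_spec (h v)
      change ρ^[d v] v = r at this
      rw [h0] at this
      exact hv this
    obtain ⟨k, hk⟩ := Nat.exists_eq_succ_of_ne_zero h0
    have h1 : ρ^[k] (ρ v) = r := by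
      have := Nat.find_spec (h v)
      change ρ^[d v] v = r at this
      rwa [hk] at this
    have : d (ρ v) ≤ k := Nat.find_min' _ h1
    omega
  have hval : ∀ i j, i ≠ j → d i ≤ d j → M i j = 0 := by
    intro i j hij hlt
    rw [hM, Matrix.of_apply]
    split_ifs with hi
    · subst hi
      simp [hij.symm]
    · have : j ≠ ρ i := by
        rintro rfl
        exact absurd (hd i hi) (not_lt.2 hlt)
      simp [hij.symm, this]
  have hdiag : ∀ i, M i i = 1 := by
    intro i
    rw [hM, Matrix.of_apply]
    split_ifs with hi
    · simp [hi]
    · have : i ≠ ρ i := by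
        intro e
        have := hd i hi
        rw [← e] at this
        exact lt_irrefl _ this
      simp [this]
  have hT : M.BlockTriangular (fun v => OrderDual.toDual (d v)) := by
    intro i j hij
    have hij' : d i < d j := hij
    exact hval i j (fun e => by simp [e] at hij') hij'.le
  rw [hT.det]
  refine Finset.prod_eq_one fun a _ => ?_
  have : M.toSquareBlock (fun v => OrderDual.toDual (d v)) a = 1 := by
    ext i j
    rw [Matrix.toSquareBlock_def, Matrix.of_apply, Matrix.one_apply]
    split_ifs with hij
    · rw [hij]; exact hdiag _
    · refine hval _ _ (fun e => hij (Subtype.ext e)) ?_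
      have := i.2.trans j.2.symm
      exact (OrderDual.toDual.injective this).le
  rw [this, Matrix.det_one]

/-- The indicator of the vertices that never reach `r` is a nonzero kernel vector: it vanishes at
`r` and is constant along `ρ`. -/
lemma det_nonTreeMatrix {r : U} {ρ : U → U} (hr : ρ r = r) (h : ¬ ∀ v, ∃ n, ρ^[n] v = r) :
    (Matrix.of fun v : U => if v = r then (Pi.single r 1 : U → ℝ)
      else Pi.single v 1 - Pi.single (ρ v) 1).det = 0 := by
  classical
  push Not at h
  obtain ⟨x, hx⟩ := h
  refine Matrix.exists_mulVec_eq_zero_iff.1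
    ⟨fun v => if ∃ n, ρ^[n] v = r then 0 else 1, fun h0 => ?_, ?_⟩
  · have := congrFun h0 x
    simp [hx] at this
  · have key : ∀ v, (∃ n, ρ^[n] (ρ v) = r) ↔ ∃ n, ρ^[n] v = r := by
      intro v
      constructor
      · rintro ⟨n, hn⟩
        exact ⟨n + 1, hn⟩
      · rintro ⟨n, hn⟩
        refine ⟨n, ?_⟩
        rw [← Function.iterate_succ_apply, Function.iterate_succ_apply', hn, hr]
    ext v
    simp only [Matrix.mulVec, Matrix.of_apply, Pi.zero_apply]
    split_ifs with hv
    · rw [single_one_dotProduct, if_pos ⟨0, rfl⟩]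
    · rw [sub_dotProduct, single_one_dotProduct, single_one_dotProduct, sub_eq_zero]
      exact (if_congr (key v) rfl rfl).symm

/-- The matrix-tree theorem for directed weights. -/
theorem treeSum_eq_sum (w : U → U → ℝ) (r : U) [DecidablePred (IsTreeMap r)] :
    treeSum w r = ∑ ρ : U → U with IsTreeMap r ρ, ∏ v ∈ Finset.univ.erase r, w v (ρ v) := by
  -- The row of `r` is also written as a sum over targets, with the single term `y = r`. Expanding
  -- the determinant multilinearly in the rows then gives a sum over all maps `ρ`, in which those
  -- with `ρ r ≠ r` have weight zero.
  let w' : U → U → ℝ := fun v y => if v = r then (if y = r then 1 else 0) else w v y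
  let R : U → U → U → ℝ := fun v y =>
    if v = r then Pi.single r 1 else Pi.single v 1 - Pi.single y 1
  have h1 : grounded w r = Matrix.of fun v => ∑ y, w' v y • R v y := by
    ext v j
    rw [grounded, Matrix.updateRow_apply, Matrix.of_apply]
    by_cases hv : v = r
    · subst hv
      simp [w', R, -Finset.sum_apply]
    · simp [w', R, hv, laplacian]
  have h2 : treeSum w r = ∑ ρ : U → U, (∏ v, w' v (ρ v)) * (Matrix.of fun v => R v (ρ v)).det := by
    rw [treeSum, h1]
    have := (Matrix.detRowAlternating (R := ℝ) (n := U)).toMultilinearMap.map_sum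
      (fun v y => w' v y • R v y)
    refine this.trans (Finset.sum_congr rfl fun ρ _ => ?_)
    rw [MultilinearMap.map_smul_univ]
    rfl
  rw [h2, Finset.sum_filter]
  refine Finset.sum_congr rfl fun ρ _ => ?_
  by_cases hr : ρ r = r
  · have h3 : ∏ v, w' v (ρ v) = ∏ v ∈ Finset.univ.erase r, w v (ρ v) := by
      rw [← Finset.mul_prod_erase _ _ (Finset.mem_univ r)]
      have : w' r (ρ r) = 1 := by simp [w', hr]
      rw [this, one_mul]
      refine Finset.prod_congr rfl fun v hv => ?_
      simp [w', Finset.ne_of_mem_erase hv]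
    rw [h3]
    split_ifs with hT
    · rw [det_treeMatrix hT.2, mul_one]
    · rw [det_nonTreeMatrix hr fun h => hT ⟨hr, h⟩, mul_zero]
  · rw [if_neg fun h => hr h.1, Finset.prod_eq_zero (Finset.mem_univ r), zero_mul]
    simp [w', hr]

lemma laplacian_mulVec_one (w : U → U → ℝ) : (laplacian w).mulVec 1 = 0 := by
  ext v
  simp [laplacian_mulVec]

lemma laplacian_det [Nonempty U] (w : U → U → ℝ) : (laplacian w).det = 0 :=
  Matrix.exists_mulVec_eq_zero_iff.1 ⟨1, one_ne_zero, laplacian_mulVec_one w⟩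

/-- Constants are in the kernel of the Laplacian. Replacing a row by a difference of two unit
vectors keeps them in the kernel, so the cofactor does not depend on `i`. -/
lemma adjugate_laplacian (w : U → U → ℝ) (i j : U) :
    (laplacian w).adjugate i j = treeSum w j := by
  rw [Matrix.adjugate_apply, treeSum, grounded, ← sub_eq_zero]
  have h := (Matrix.detRowAlternating (R := ℝ) (n := U)).map_update_sub (laplacian w) j
    (Pi.single i 1) (Pi.single j 1)
  refine Eq.trans h.symm ?_
  change ((laplacian w).updateRow j (Pi.single i 1 - Pi.single j 1)).det = 0
  refine Matrix.exists_mulVec_eq_zero_iff.1 ⟨1, ?_, ?_⟩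
  · intro h0
    exact one_ne_zero (congrFun h0 i)
  · rw [Matrix.updateRow_mulVec, laplacian_mulVec_one]
    ext v
    rcases eq_or_ne v j with rfl | hv
    · simp [sub_dotProduct]
    · simp [hv]

/-- The Markov chain tree theorem: the tree sums form an invariant measure. -/
lemma sum_treeSum_mul (w : U → U → ℝ) (x : U) :
    ∑ y, treeSum w y * w y x = treeSum w x * ∑ y, w x y := by
  have : Nonempty U := ⟨x⟩
  -- Each row of the adjugate lists the tree sums, and the adjugate times the singular Laplacian is
  -- zero: the tree sums form a left null vector.
  have h := congrFun (congrFun (Matrix.adjugate_mul (laplacian w)) x) x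
  rw [laplacian_det, zero_smul, Matrix.mul_apply] at h
  simp only [adjugate_laplacian, laplacian_apply, mul_sub, mul_ite, mul_zero,
    Finset.sum_sub_distrib, Finset.sum_ite_eq', Finset.mem_univ, if_true, Matrix.zero_apply] at h
  linarith

/-- A symmetric Laplacian has a symmetric adjugate, while the entries of the adjugate depend on the
column only. -/
lemma treeSum_eq_of_symm {c : U → U → ℝ} (hc : ∀ x y, c x y = c y x) (x y : U) :
    treeSum c x = treeSum c y := by
  have hL : (laplacian c).transpose = laplacian c := by
    ext i j
    rw [Matrix.transpose_apply, laplacian_apply, laplacian_apply, hc j i]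
    rcases eq_or_ne i j with rfl | h
    · rfl
    · simp [h, h.symm]
  have h := Matrix.adjugate_transpose (laplacian c)
  rw [hL] at h
  have := congrFun (congrFun h y) x
  rw [Matrix.transpose_apply, adjugate_laplacian, adjugate_laplacian] at this
  exact this.symm

/-- Tree sums are invariant under relabelling. -/
lemma treeSum_comp_equiv {U' : Type*} [Fintype U'] [DecidableEq U'] (e : U ≃ U')
    (w : U' → U' → ℝ) (r : U) :
    treeSum (fun x y => w (e x) (e y)) r = treeSum w (e r) := by
  rw [treeSum, treeSum, ← Matrix.det_submatrix_equiv_self e]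
  congr 1
  ext i j
  rw [Matrix.submatrix_apply, grounded, grounded, Matrix.updateRow_apply, Matrix.updateRow_apply,
    laplacian_apply, laplacian_apply]
  simp only [e.injective.eq_iff, Pi.single_apply]
  rw [e.sum_comp (fun y => w (e j) y)]

lemma treeSum_congr {w w' : U → U → ℝ} {r : U} (h : ∀ v, v ≠ r → ∀ y, w v y = w' v y) :
    treeSum w r = treeSum w' r := by
  classical
  rw [treeSum_eq_sum, treeSum_eq_sum]
  refine Finset.sum_congr rfl fun ρ _ => Finset.prod_congr rfl fun v hv => ?_
  exact h v (Finset.ne_of_mem_erase hv) _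

end DirectedLaplacian

/-! ### Dirichlet energy, Green functions and the determinant formula for tree ratios. -/

namespace DirectedLaplacian

variable {U : Type*} [Fintype U] [DecidableEq U]

/-- The Dirichlet form of the conductances `c`. -/
def dirichlet (c : U → U → ℝ) (f h : U → ℝ) : ℝ :=
  (∑ a, ∑ b, c a b * ((f a - f b) * (h a - h b))) / 2

/-- The Green function of the walk killed at `r`. -/
def green (c : U → U → ℝ) (r : U) : Matrix U U ℝ := (grounded c r)⁻¹

/-- The energy of the charge distribution `a`. -/
def chargeEnergy (c : U → U → ℝ) (r : U) (a : U → ℝ) : ℝ := a ⬝ᵥ (green c r).mulVec a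

omit [DecidableEq U] in
lemma dirichlet_self_nonneg {c : U → U → ℝ} (hc : ∀ x y, 0 ≤ c x y) (f : U → ℝ) :
    0 ≤ dirichlet c f f :=
  div_nonneg (Finset.sum_nonneg fun _ _ => Finset.sum_nonneg fun _ _ =>
    mul_nonneg (hc _ _) (mul_self_nonneg _)) zero_le_two

omit [DecidableEq U] in
lemma dirichlet_sub_self (c : U → U → ℝ) (f h : U → ℝ) :
    dirichlet c (f - h) (f - h) = dirichlet c f f - 2 * dirichlet c f h + dirichlet c h h := by
  simp only [dirichlet, Pi.sub_apply]
  rw [← mul_div_assoc, Finset.mul_sum, ← sub_div, ← add_div, ← Finset.sum_sub_distrib,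
    ← Finset.sum_add_distrib]
  congr 1
  refine Finset.sum_congr rfl fun a _ => ?_
  rw [Finset.mul_sum, ← Finset.sum_sub_distrib, ← Finset.sum_add_distrib]
  refine Finset.sum_congr rfl fun b _ => ?_
  ring

/-- Summation by parts; the factor `1/2` compensates for counting every edge in both directions. -/
lemma dirichlet_eq_dotProduct {c : U → U → ℝ} (hc : ∀ x y, c x y = c y x) (f h : U → ℝ) :
    dirichlet c f h = h ⬝ᵥ (laplacian c).mulVec f := by
  have h1 : h ⬝ᵥ (laplacian c).mulVec f = ∑ a, ∑ b, c a b * ((f a - f b) * h a) := by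
    simp only [dotProduct, laplacian_mulVec, Finset.mul_sum]
    exact Finset.sum_congr rfl fun a _ => Finset.sum_congr rfl fun b _ => by ring
  have h2 : h ⬝ᵥ (laplacian c).mulVec f = - ∑ a, ∑ b, c a b * ((f a - f b) * h b) := by
    rw [h1, Finset.sum_comm, ← Finset.sum_neg_distrib]
    refine Finset.sum_congr rfl fun a _ => ?_
    rw [← Finset.sum_neg_distrib]
    refine Finset.sum_congr rfl fun b _ => ?_
    rw [hc]
    ring
  have h3 : dirichlet c f h = ((∑ a, ∑ b, c a b * ((f a - f b) * h a)) -
      ∑ a, ∑ b, c a b * ((f a - f b) * h b)) / 2 := by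
    simp only [dirichlet, mul_sub, Finset.sum_sub_distrib]
  linarith

/-- Symmetric nonnegative conductances for which only the constants have zero energy. -/
structure IsConductance (c : U → U → ℝ) : Prop where
  symm : ∀ x y, c x y = c y x
  nonneg : ∀ x y, 0 ≤ c x y
  const : ∀ f, dirichlet c f f = 0 → ∀ a b, f a = f b

variable {c : U → U → ℝ}

/-- A kernel vector of the grounded Laplacian vanishes at `r` and is harmonic elsewhere. It
therefore has zero energy, so it is constant and equal to zero. -/
lemma IsConductance.treeSum_ne_zero (hc : IsConductance c) (r : U) : treeSum c r ≠ 0 := by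
  intro h
  obtain ⟨f, hf0, hf⟩ := Matrix.exists_mulVec_eq_zero_iff.2 h
  rw [grounded, Matrix.updateRow_mulVec] at hf
  have hr : f r = 0 := by simpa using congrFun hf r
  have hE : dirichlet c f f = 0 := by
    rw [dirichlet_eq_dotProduct hc.symm]
    refine Finset.sum_eq_zero fun v _ => ?_
    rcases eq_or_ne v r with rfl | hv
    · rw [hr, zero_mul]
    · have := congrFun hf v
      rw [Function.update_of_ne hv] at this
      rw [this, Pi.zero_apply, mul_zero]
  refine hf0 (funext fun v => ?_)
  rw [hc.const f hE v r, hr, Pi.zero_apply]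

lemma IsConductance.treeSum_pos (hc : IsConductance c) (r : U) : 0 < treeSum c r := by
  classical
  refine lt_of_le_of_ne ?_ (hc.treeSum_ne_zero r).symm
  rw [treeSum_eq_sum]
  exact Finset.sum_nonneg fun ρ _ => Finset.prod_nonneg fun v _ => hc.nonneg _ _

lemma IsConductance.grounded_mul_green (hc : IsConductance c) (r : U) :
    grounded c r * green c r = 1 :=
  Matrix.mul_nonsing_inv _ (Ne.isUnit (hc.treeSum_ne_zero r))

lemma IsConductance.grounded_potential (hc : IsConductance c) (r : U) (a : U → ℝ) :
    Function.update ((laplacian c).mulVec ((green c r).mulVec a)) r ((green c r).mulVec a r) =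
      a := by
  have h : (grounded c r).mulVec ((green c r).mulVec a) = a := by
    rw [Matrix.mulVec_mulVec, hc.grounded_mul_green, Matrix.one_mulVec]
  rw [grounded, Matrix.updateRow_mulVec, single_one_dotProduct] at h
  exact h

lemma IsConductance.potential_root (hc : IsConductance c) {r : U} {a : U → ℝ} (ha : a r = 0) :
    (green c r).mulVec a r = 0 := by
  simpa [ha] using congrFun (hc.grounded_potential r a) r

lemma IsConductance.green_root (hc : IsConductance c) {r y : U} (hy : y ≠ r) :
    green c r r y = 0 := by
  simpa using hc.potential_root (r := r) (a := Pi.single y 1) (by simp [hy.symm])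

/-- Reproducing property of the Green function: off `r` the Laplacian of the potential is the
charge, and `r` contributes nothing because `h` vanishes there. -/
lemma IsConductance.dirichlet_potential (hc : IsConductance c) {r : U} (a : U → ℝ)
    {h : U → ℝ} (hr : h r = 0) : dirichlet c ((green c r).mulVec a) h = a ⬝ᵥ h := by
  rw [dirichlet_eq_dotProduct hc.symm, dotProduct_comm]
  refine Finset.sum_congr rfl fun v _ => ?_
  rcases eq_or_ne v r with rfl | hv
  · rw [hr, mul_zero, mul_zero]
  · have := congrFun (hc.grounded_potential r a) v
    rw [Function.update_of_ne hv] at this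
    rw [this]

lemma IsConductance.dirichlet_potential_self (hc : IsConductance c) {r : U} {a : U → ℝ}
    (ha : a r = 0) :
    dirichlet c ((green c r).mulVec a) ((green c r).mulVec a) = chargeEnergy c r a :=
  hc.dirichlet_potential a (hc.potential_root ha)

/-- The energy of a charge distribution as a supremum. -/
lemma IsConductance.le_chargeEnergy (hc : IsConductance c) {r : U} {a h : U → ℝ}
    (ha : a r = 0) (hr : h r = 0) : 2 * (a ⬝ᵥ h) - dirichlet c h h ≤ chargeEnergy c r a := by
  have h1 := dirichlet_self_nonneg hc.nonneg ((green c r).mulVec a - h)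
  rw [dirichlet_sub_self, hc.dirichlet_potential_self ha, hc.dirichlet_potential a hr] at h1
  linarith

lemma IsConductance.green_symm (hc : IsConductance c) {r x y : U} (hx : x ≠ r) (hy : y ≠ r) :
    green c r x y = green c r y x := by
  have h1 := hc.dirichlet_potential (r := r) (Pi.single x 1)
    (hc.potential_root (r := r) (a := Pi.single y 1) (by simp [hy.symm]))
  have h2 := hc.dirichlet_potential (r := r) (Pi.single y 1)
    (hc.potential_root (r := r) (a := Pi.single x 1) (by simp [hx.symm]))
  have h3 : ∀ f h, dirichlet c f h = dirichlet c h f := fun f h => by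
    simp only [dirichlet, mul_comm]
  rw [h3, h2] at h1
  simpa using h1.symm

lemma chargeEnergy_single (c : U → U → ℝ) (r x : U) :
    chargeEnergy c r (Pi.single x 1) = green c r x x := by
  simp [chargeEnergy]

/-- Reduces the convergence of Green function values to that of energies, for which there is
monotonicity. -/
lemma IsConductance.green_polarization (hc : IsConductance c) {r x y : U} (hx : x ≠ r)
    (hy : y ≠ r) :
    green c r x y = (chargeEnergy c r (Pi.single x 1 + Pi.single y 1) -
      chargeEnergy c r (Pi.single x 1) - chargeEnergy c r (Pi.single y 1)) / 2 := by
  rw [chargeEnergy_single, chargeEnergy_single]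
  simp only [chargeEnergy, Matrix.mulVec_add, add_dotProduct, dotProduct_add,
    single_one_dotProduct, Matrix.mulVec_single_one, Matrix.col_apply]
  rw [hc.green_symm hy hx]
  ring

/-- The energy of charges increases along a map that does not increase energies. -/
lemma chargeEnergy_mono {U' : Type*} [Fintype U'] [DecidableEq U'] {c' : U' → U' → ℝ}
    (hc : IsConductance c) (hc' : IsConductance c') {r : U} {r' : U'} {a : U → ℝ} {a' : U' → ℝ}
    (ha : a r = 0) (ha' : a' r' = 0) (φ : U' → U) (hr : φ r' = r)
    (haφ : ∀ h : U → ℝ, a' ⬝ᵥ (h ∘ φ) = a ⬝ᵥ h)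
    (hφ : ∀ h : U → ℝ, dirichlet c' (h ∘ φ) (h ∘ φ) ≤ dirichlet c h h) :
    chargeEnergy c r a ≤ chargeEnergy c' r' a' := by
  -- The test function in the variational bound is the pullback of the optimal potential.
  have h1 := hc'.le_chargeEnergy (r := r') (a := a') (h := (green c r).mulVec a ∘ φ) ha'
    (by rw [Function.comp_apply, hr, hc.potential_root ha])
  rw [haφ] at h1
  have h2 := hφ ((green c r).mulVec a)
  rw [hc.dirichlet_potential_self ha] at h2
  have h3 : a ⬝ᵥ (green c r).mulVec a = chargeEnergy c r a := rfl
  linarith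

lemma det_toSquareBlockProp {ι : Type*} [Fintype ι] [DecidableEq ι] (M : Matrix U U ℝ)
    (p : U → Prop) [DecidablePred p] (e : ι ≃ {v // p v}) :
    (M.toSquareBlockProp p).det =
      (M.submatrix (fun i => (e i : U)) (fun i => (e i : U))).det := by
  rw [← Matrix.det_submatrix_equiv_self e (M.toSquareBlockProp p)]
  rfl

/-- The tree sum of weights that differ from `c` in the rows `κ i` only. -/
lemma IsConductance.treeSum_eq_mul_det (hc : IsConductance c) {r : U} {ι : Type*} [Fintype ι]
    [DecidableEq ι] {κ : ι → U} (hκ : Function.Injective κ) (hr : r ∉ Set.range κ)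
    {w : U → U → ℝ} (hw : ∀ v, v ∉ Set.range κ → v ≠ r → ∀ y, w v y = c v y) :
    treeSum w r = treeSum c r * (Matrix.of fun i j : ι =>
      ∑ y, w (κ i) y * (green c r (κ i) (κ j) - green c r y (κ j))).det := by
  classical
  -- The Green function is the inverse of the grounded Laplacian of `c`, so its determinant cancels
  -- `treeSum c r`.
  have h1 : treeSum w r = treeSum c r * (grounded w r * green c r).det := by
    have h2 : (green c r).det * treeSum c r = 1 := by
      rw [treeSum, mul_comm, ← Matrix.det_mul, hc.grounded_mul_green, Matrix.det_one]
    rw [Matrix.det_mul, treeSum, mul_left_comm, mul_comm (treeSum c r), h2, mul_one]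
  rw [h1]
  congr 1
  -- In the rows where `w` and `c` agree, and in the row of `r`, the product is the identity; only
  -- the block indexed by `κ` contributes to its determinant.
  have hrow : ∀ v, v ∉ Set.range κ → ∀ y, (grounded w r * green c r) v y =
      (1 : Matrix U U ℝ) v y := by
    intro v hv y
    rw [← hc.grounded_mul_green r, Matrix.mul_apply, Matrix.mul_apply]
    refine Finset.sum_congr rfl fun z _ => ?_
    congr 1
    rw [grounded, grounded, Matrix.updateRow_apply, Matrix.updateRow_apply]
    split_ifs with h
    · rfl
    · simp only [laplacian, Matrix.of_apply]
      exact congrFun (Finset.sum_congr rfl fun t _ => by rw [hw v hv h]) z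
  rw [Matrix.twoBlockTriangular_det _ (fun v => v ∈ Set.range κ)]
  · have h3 : ((grounded w r * green c r).toSquareBlockProp fun v => ¬ v ∈ Set.range κ) = 1 := by
      ext i j
      rw [Matrix.toSquareBlockProp_def, Matrix.of_apply, hrow _ i.2, Matrix.one_apply,
        Matrix.one_apply]
      exact if_congr Subtype.ext_iff.symm rfl rfl
    rw [h3, Matrix.det_one, mul_one]
    rw [det_toSquareBlockProp _ _ (Equiv.ofInjective κ hκ)]
    congr 1
    ext i j
    rw [Matrix.submatrix_apply, Matrix.of_apply]
    have hi : κ i ≠ r := fun h => hr ⟨i, h⟩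
    have := laplacian_mulVec w (fun y => green c r y (κ j)) (κ i)
    rw [← this]
    simp only [Equiv.ofInjective_apply]
    rw [Matrix.mul_apply, grounded]
    simp only [Matrix.updateRow_ne hi]
    rfl
  · intro i hi j hj
    rw [hrow i hi, Matrix.one_apply_ne]
    rintro rfl
    exact hi hj

end DirectedLaplacian

/-! ### Oriented spanning trees of finite networks and their inclusion probabilities. -/

namespace ElectricalNetwork

open DirectedLaplacian

section Trees

variable {U : Type u} {G : SimpleGraph U}

/-- The oriented edges `(v, ρ v)` with `v ≠ r`. -/
def treeOf (G : SimpleGraph U) (r : U) (ρ : U → U) : Set G.Dart :=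
  {d | d.fst ≠ r ∧ d.snd = ρ d.fst}

/-- Outdegree at most one forces every step, and the absence of edges out of `z` forces both walks
to stop at their first visit to `z`. -/
lemma walk_unique {T : Set G.Dart} (hT : ∀ d ∈ T, ∀ e ∈ T, d.fst = e.fst → d.snd = e.snd)
    {x z : U} (hz : ∀ d ∈ T, d.fst ≠ z) (p q : G.Walk x z) (hp : ∀ d ∈ p.darts, d ∈ T)
    (hq : ∀ d ∈ q.darts, d ∈ T) : p = q := by
  induction p with
  | nil =>
    cases q with
    | nil => rfl
    | cons h q => exact absurd rfl (hz ⟨(_, _), h⟩ (hq _ (by simp)))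
  | cons h p ih =>
    cases q with
    | nil => exact absurd rfl (hz ⟨(_, _), h⟩ (hp _ (by simp)))
    | cons h' q =>
      have : _ = _ := hT ⟨(_, _), h⟩ (hp _ (by simp)) ⟨(_, _), h'⟩ (hq _ (by simp)) rfl
      simp only at this
      subst this
      rw [ih hz q (fun d hd => hp d (by simp [hd])) (fun d hd => hq d (by simp [hd]))]

lemma isOrientedSpanningTree_treeOf {r : U} {ρ : U → U} (hρ : IsTreeMap r ρ)
    (hadj : ∀ v, v ≠ r → G.Adj v (ρ v)) : IsOrientedSpanningTree G r (treeOf G r ρ) := by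
  intro x
  have hex : ∀ n x, ρ^[n] x = r → ∃ p : G.Walk x r, ∀ d ∈ p.darts, d ∈ treeOf G r ρ := by
    intro n
    induction n with
    | zero =>
      rintro x rfl
      exact ⟨SimpleGraph.Walk.nil, by simp⟩
    | succ n ih =>
      intro x hx
      by_cases hxr : x = r
      · subst hxr
        exact ⟨SimpleGraph.Walk.nil, by simp⟩
      · obtain ⟨p, hp⟩ := ih (ρ x) hx
        refine ⟨SimpleGraph.Walk.cons (hadj x hxr) p, ?_⟩
        intro d hd
        rw [SimpleGraph.Walk.darts_cons, List.mem_cons] at hd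
        rcases hd with rfl | hd
        · exact ⟨hxr, rfl⟩
        · exact hp d hd
  obtain ⟨n, hn⟩ := hρ.2 x
  obtain ⟨p, hp⟩ := hex n x hn
  refine ⟨p, hp, fun q hq => walk_unique (T := treeOf G r ρ) ?_ (fun d hd => hd.1) q p hq hp⟩
  intro d hd e he hde
  rw [hd.2, he.2, hde]

/-- Prefixing an edge of `T` to the walk from its head gives a walk in `T` to the root. Uniqueness
then excludes edges out of `r` (compare with the trivial walk) and two edges out of one vertex, so
the parent map is well defined. -/
lemma exists_treeOf_eq {r : U} {T : Set G.Dart} (hT : IsOrientedSpanningTree G r T) :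
    ∃ ρ : U → U, IsTreeMap r ρ ∧ (∀ v, v ≠ r → G.Adj v (ρ v)) ∧ treeOf G r ρ = T := by
  classical
  have hcons : ∀ d ∈ T, ∃ p : G.Walk d.snd r, ∀ e ∈ (SimpleGraph.Walk.cons d.adj p).darts,
      e ∈ T := by
    intro d hd
    obtain ⟨p, hp, -⟩ := hT d.snd
    refine ⟨p, fun e he => ?_⟩
    rw [SimpleGraph.Walk.darts_cons, List.mem_cons] at he
    rcases he with rfl | he
    · exact hd
    · exact hp e he
  have h1 : ∀ d ∈ T, d.fst ≠ r := by
    rintro d hd rfl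
    obtain ⟨p, hp⟩ := hcons d hd
    have := (hT d.fst).unique hp (y₂ := SimpleGraph.Walk.nil) (by simp)
    cases this
  have h2 : ∀ d ∈ T, ∀ e ∈ T, d.fst = e.fst → d.snd = e.snd := by
    rintro ⟨⟨a, b⟩, hd⟩ hdT ⟨⟨a', b'⟩, he⟩ heT (rfl : a = a')
    obtain ⟨p, hp⟩ := hcons _ hdT
    obtain ⟨q, hq⟩ := hcons _ heT
    have := (hT a).unique hp hq
    rw [SimpleGraph.Walk.cons.injEq] at this
    exact this.1
  have h3 : ∀ x, ∃ y, (x = r → y = r) ∧ (x ≠ r → ∃ d ∈ T, d.fst = x ∧ d.snd = y) := by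
    intro x
    obtain ⟨p, hp, -⟩ := hT x
    cases p with
    | nil => exact ⟨r, fun _ => rfl, fun h => absurd rfl h⟩
    | cons h p =>
      refine ⟨_, fun hx => ?_, fun _ => ⟨⟨(_, _), h⟩, hp _ (by simp), rfl, rfl⟩⟩
      exact absurd hx (h1 ⟨(_, _), h⟩ (hp _ (by simp)))
  choose ρ hρr hρT using h3
  replace hρr := hρr r rfl
  have hρ : ∀ d ∈ T, d.snd = ρ d.fst := by
    intro d hd
    obtain ⟨e, he, he1, he2⟩ := hρT _ (h1 d hd)
    rw [← he2]
    exact h2 d hd e he he1.symm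
  refine ⟨ρ, ⟨hρr, fun v => ?_⟩, fun v hv => ?_, ?_⟩
  · obtain ⟨p, hp, -⟩ := hT v
    have hit : ∀ {v z : U} (p : G.Walk v z), (∀ d ∈ p.darts, d ∈ T) → ∃ n, ρ^[n] v = z := by
      intro v z p
      induction p with
      | nil => exact fun _ => ⟨0, rfl⟩
      | cons h p ih =>
        intro hp
        obtain ⟨n, hn⟩ := ih fun d hd => hp d (by simp [hd])
        refine ⟨n + 1, ?_⟩
        rw [Function.iterate_succ_apply, ← hn]
        exact congrArg _ (hρ ⟨(_, _), h⟩ (hp _ (by simp))).symm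
    exact hit p hp
  · obtain ⟨e, -, he1, he2⟩ := hρT v hv
    rw [← he2]
    exact he1 ▸ e.adj
  · ext d
    constructor
    · rintro ⟨hd1, hd2⟩
      obtain ⟨e, he, he1, he2⟩ := hρT _ hd1
      have : d = e := SimpleGraph.Dart.ext _ _ (Prod.ext he1.symm (hd2.trans he2.symm))
      rwa [this]
    · exact fun hd => ⟨h1 d hd, hρ d hd⟩

lemma treeOf_injOn (r : U) :
    Set.InjOn (treeOf G r) {ρ | IsTreeMap r ρ ∧ ∀ v, v ≠ r → G.Adj v (ρ v)} := by
  intro ρ hρ σ hσ h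
  funext v
  rcases eq_or_ne v r with rfl | hv
  · rw [hρ.1.1, hσ.1.1]
  · have : (⟨(v, ρ v), hρ.2 v hv⟩ : G.Dart) ∈ treeOf G r σ := h ▸ ⟨hv, rfl⟩
    exact this.2

end Trees

/-- The conductances of a network, extended by `0` to pairs that are not edges. -/
def cond {V : Type u} (N : ElectricalNetwork V) (x y : V) : ℝ :=
  open Classical in if N.graph.Adj x y then N.c x y else 0

/-- The weights `w` restricted to the transitions that are compatible with the edges in `E`. -/
def restrictTo {V : Type u} (E : Set (V × V)) (w : V → V → ℝ) (v y : V) : ℝ :=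
  open Classical in if ∀ b, (v, b) ∈ E → b = y then w v y else 0

lemma restrictTo_congr {V V' : Type*} {E : Set (V × V)} {E' : Set (V' × V')} {w : V → V → ℝ}
    {w' : V' → V' → ℝ} {v y : V} {v' y' : V'} (hw : w v y = w' v' y')
    (key : (∀ b, (v, b) ∈ E → b = y) ↔ ∀ b, (v', b) ∈ E' → b = y') :
    restrictTo E w v y = restrictTo E' w' v' y' := by
  unfold restrictTo
  by_cases h : ∀ b, (v, b) ∈ E → b = y
  · rw [if_pos h, if_pos (key.1 h), hw]
  · rw [if_neg h, if_neg fun h' => h (key.2 h')]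

section Basic

variable {V : Type u} (N : ElectricalNetwork V)

lemma cond_of_adj {x y : V} (h : N.graph.Adj x y) : N.cond x y = N.c x y := if_pos h

lemma cond_of_not_adj {x y : V} (h : ¬ N.graph.Adj x y) : N.cond x y = 0 := if_neg h

lemma cond_nonneg (x y : V) : 0 ≤ N.cond x y := by
  unfold cond
  split_ifs with h
  · exact (N.c_pos x y h).le
  · exact le_rfl

lemma cond_symm (x y : V) : N.cond x y = N.cond y x := by
  unfold cond
  by_cases h : N.graph.Adj x y
  · rw [if_pos h, if_pos h.symm, N.c_symm x y h]
  · rw [if_neg h, if_neg fun h' => h h'.symm]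

lemma restrictTo_nonneg {E : Set (V × V)} {w : V → V → ℝ} (hw : ∀ x y, 0 ≤ w x y) (x y : V) :
    0 ≤ restrictTo E w x y := by
  unfold restrictTo
  split_ifs
  · exact hw x y
  · exact le_rfl

end Basic

section Finite

variable {U : Type u} [Fintype U] [DecidableEq U] (N : ElectricalNetwork U)

omit [DecidableEq U] in
lemma isConductance_cond : IsConductance N.cond where
  symm := N.cond_symm
  nonneg := N.cond_nonneg
  const f hf := by
    have h0 : ∑ a, ∑ b, N.cond a b * ((f a - f b) * (f a - f b)) = 0 := by
      have : (∑ a, ∑ b, N.cond a b * ((f a - f b) * (f a - f b))) / 2 = 0 := hf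
      linarith
    have hnn : ∀ a b, 0 ≤ N.cond a b * ((f a - f b) * (f a - f b)) := fun a b =>
      mul_nonneg (N.cond_nonneg a b) (mul_self_nonneg _)
    have hadj : ∀ a b, N.graph.Adj a b → f a = f b := by
      intro a b hab
      have h1 := (Finset.sum_eq_zero_iff_of_nonneg
        (fun a _ => Finset.sum_nonneg fun b _ => hnn a b)).1 h0 a (Finset.mem_univ a)
      have h2 := (Finset.sum_eq_zero_iff_of_nonneg (fun b _ => hnn a b)).1 h1 b
        (Finset.mem_univ b)
      rw [N.cond_of_adj hab, mul_eq_zero, mul_self_eq_zero, sub_eq_zero] at h2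
      exact h2.resolve_left (N.c_pos a b hab).ne'
    intro a b
    obtain ⟨p⟩ := N.connected.preconnected a b
    induction p with
    | nil => rfl
    | cons h p ih => exact (hadj _ _ h).trans ih

lemma weight_treeOf {r : U} {ρ : U → U} (hadj : ∀ v, v ≠ r → N.graph.Adj v (ρ v)) :
    N.weight (treeOf N.graph r ρ) = ∏ v ∈ Finset.univ.erase r, N.cond v (ρ v) := by
  rw [weight, ← finprod_mem_finset_eq_prod]
  refine finprod_mem_eq_of_bijOn (fun d => d.fst) ⟨?_, ?_, ?_⟩ ?_
  · intro d hd
    simpa using hd.1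
  · intro d hd e he hde
    refine SimpleGraph.Dart.ext _ _ (Prod.ext hde ?_)
    rw [hd.2, he.2]
    exact congrArg ρ hde
  · intro v hv
    have hv : v ≠ r := by simpa using hv
    exact ⟨⟨(v, ρ v), hadj v hv⟩, ⟨hv, rfl⟩, rfl⟩
  · intro d hd
    rw [← hd.2, N.cond_of_adj d.adj]

/-- The oriented subgraphs that contain the pairs in `E`. -/
def containsPairs (N : ElectricalNetwork U) (E : Set (U × U)) : Set (Set N.graph.Dart) :=
  {T | ∀ e ∈ E, ∃ d ∈ T, d.fst = e.1 ∧ d.snd = e.2}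

omit [DecidableEq U] in
lemma measurableSet_containsPairs (E : Set (U × U)) : MeasurableSet (N.containsPairs E) := by
  have : Finite N.graph.Dart := Finite.of_injective (fun d => d.toProd)
    fun d e h => SimpleGraph.Dart.ext _ _ h
  exact (Set.toFinite _).measurableSet

/-- Restricting the weights gives weight zero to exactly the trees that disagree with `E`. Pairs
with source `r` are excluded because tree sums ignore the row of `r`, whereas no tree has an edge
out of `r`. -/
lemma treeMeasure_containsPairs (r : U) {E : Set (U × U)} (hE : ∀ b, (r, b) ∉ E) :
    N.treeMeasure r (N.containsPairs E) = ENNReal.ofReal (treeSum (restrictTo E N.cond) r) := by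
  classical
  have hbij : Function.Bijective (fun ρ : {ρ : U → U // IsTreeMap r ρ ∧
      ∀ v, v ≠ r → N.graph.Adj v (ρ v)} =>
      (⟨treeOf N.graph r ρ.1, isOrientedSpanningTree_treeOf ρ.2.1 ρ.2.2⟩ :
        {T : Set N.graph.Dart // IsOrientedSpanningTree N.graph r T})) := by
    constructor
    · intro ρ σ h
      exact Subtype.ext (treeOf_injOn r ρ.2 σ.2 (Subtype.ext_iff.1 h))
    · rintro ⟨T, hT⟩
      obtain ⟨ρ, h1, h2, h3⟩ := exists_treeOf_eq hT
      exact ⟨⟨ρ, h1, h2⟩, Subtype.ext h3⟩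
  rw [treeMeasure, Measure.sum_apply _ (N.measurableSet_containsPairs E),
    ← (Equiv.ofBijective _ hbij).tsum_eq, tsum_fintype, treeSum_eq_sum,
    ENNReal.ofReal_sum_of_nonneg fun ρ _ => Finset.prod_nonneg fun v _ =>
      restrictTo_nonneg N.cond_nonneg _ _]
  simp only [Equiv.ofBijective_apply, Measure.smul_apply, smul_eq_mul,
    Measure.dirac_apply' _ (N.measurableSet_containsPairs E)]
  have key : ∀ ρ : U → U, IsTreeMap r ρ → (∀ v, v ≠ r → N.graph.Adj v (ρ v)) →
      ENNReal.ofReal (N.weight (treeOf N.graph r ρ)) *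
        (N.containsPairs E).indicator 1 (treeOf N.graph r ρ) =
      ENNReal.ofReal (∏ v ∈ Finset.univ.erase r, restrictTo E N.cond v (ρ v)) := by
    intro ρ _ hadj
    by_cases hc : ∀ e ∈ E, e.2 = ρ e.1
    · have : treeOf N.graph r ρ ∈ N.containsPairs E := by
        rintro ⟨a, b⟩ he
        have ha : a ≠ r := fun h => hE b (h ▸ he)
        exact ⟨⟨(a, ρ a), hadj a ha⟩, ⟨ha, rfl⟩, rfl, (hc _ he).symm⟩
      rw [Set.indicator_of_mem this, Pi.one_apply, mul_one, N.weight_treeOf hadj]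
      congr 1
      refine Finset.prod_congr rfl fun v _ => ?_
      rw [restrictTo, if_pos fun b hb => hc _ hb]
    · have : treeOf N.graph r ρ ∉ N.containsPairs E := by
        intro h
        refine hc fun e he => ?_
        obtain ⟨d, hd, h1, h2⟩ := h e he
        rw [← h1, ← h2, hd.2]
      rw [Set.indicator_of_notMem this, mul_zero]
      push Not at hc
      obtain ⟨⟨a, b⟩, he, hne⟩ := hc
      have ha : a ≠ r := fun h => hE b (h ▸ he)
      rw [Finset.prod_eq_zero (i := a) (by simp [ha]), ENNReal.ofReal_zero]
      rw [restrictTo, if_neg]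
      exact fun h => hne (h b he)
  have h1 : ∀ ρ : {ρ : U → U // IsTreeMap r ρ ∧ ∀ v, v ≠ r → N.graph.Adj v (ρ v)},
      _ := fun ρ => key ρ.1 ρ.2.1 ρ.2.2
  rw [Finset.sum_congr rfl fun ρ _ => h1 ρ]
  rw [← Finset.sum_subtype (Finset.univ.filter fun ρ : U → U => IsTreeMap r ρ ∧
    ∀ v, v ≠ r → N.graph.Adj v (ρ v)) (by simp) (fun ρ => ENNReal.ofReal
      (∏ v ∈ Finset.univ.erase r, restrictTo E N.cond v (ρ v)))]
  -- Parent maps that use a pair which is not an edge have weight zero.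
  refine Finset.sum_subset (fun ρ hρ => ?_) fun ρ hρ hρ' => ?_
  · rw [Finset.mem_filter] at hρ ⊢
    exact ⟨hρ.1, hρ.2.1⟩
  · have h2 : ¬ ∀ v, v ≠ r → N.graph.Adj v (ρ v) := fun h =>
      hρ' (Finset.mem_filter.2 ⟨Finset.mem_univ _, (Finset.mem_filter.1 hρ).2, h⟩)
    push Not at h2
    obtain ⟨v, hv, hadj⟩ := h2
    rw [Finset.prod_eq_zero (i := v) (by simp [hv]), ENNReal.ofReal_zero]
    rw [restrictTo, N.cond_of_not_adj hadj, ite_self]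

lemma treeMeasure_univ (r : U) :
    N.treeMeasure r Set.univ = ENNReal.ofReal (treeSum N.cond r) := by
  have h := N.treeMeasure_containsPairs r (E := ∅) (by simp)
  have h1 : N.containsPairs ∅ = Set.univ := Set.eq_univ_of_forall fun T e he => he.elim
  have h2 : restrictTo ∅ N.cond = N.cond := by
    funext v y
    simp [restrictTo]
  rwa [h1, h2] at h

instance isProbabilityMeasure_finiteOrientedWSF (r : U) :
    IsProbabilityMeasure (N.finiteOrientedWSF r) := by
  refine ⟨?_⟩
  rw [finiteOrientedWSF, Measure.smul_apply, smul_eq_mul, treeMeasure_univ]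
  refine ENNReal.inv_mul_cancel ?_ ENNReal.ofReal_ne_top
  exact (ENNReal.ofReal_pos.2 (N.isConductance_cond.treeSum_pos r)).ne'

lemma finiteOrientedWSF_containsPairs (r : U) {E : Set (U × U)} (hE : ∀ b, (r, b) ∉ E) :
    N.finiteOrientedWSF r (N.containsPairs E) =
      ENNReal.ofReal (treeSum (restrictTo E N.cond) r / treeSum N.cond r) := by
  rw [finiteOrientedWSF, Measure.smul_apply, smul_eq_mul, treeMeasure_univ,
    N.treeMeasure_containsPairs r hE, ENNReal.ofReal_div_of_pos
      (N.isConductance_cond.treeSum_pos r), mul_comm, div_eq_mul_inv]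

omit [DecidableEq U] in
lemma finiteOrientedWSF_containsPairs_of_root (r : U) {E : Set (U × U)} {b : U}
    (hE : (r, b) ∈ E) : N.finiteOrientedWSF r (N.containsPairs E) = 0 := by
  classical
  rw [finiteOrientedWSF, Measure.smul_apply, smul_eq_mul, treeMeasure,
    Measure.sum_apply _ (N.measurableSet_containsPairs E)]
  refine mul_eq_zero_of_right _ (ENNReal.tsum_eq_zero.2 fun T => ?_)
  obtain ⟨ρ, -, -, hT⟩ := exists_treeOf_eq T.2
  rw [Measure.smul_apply, Measure.dirac_apply' _ (N.measurableSet_containsPairs E),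
    Set.indicator_of_notMem, smul_zero]
  intro h
  obtain ⟨d, hd, h1, -⟩ := h _ hE
  rw [← hT] at hd
  exact hd.1 h1

end Finite

end ElectricalNetwork

/-! ### Wired quotients: local conductances and energies. -/

namespace ElectricalNetwork

open DirectedLaplacian

instance {V : Type u} (W : Finset V) : Fintype (WiredVertex W) := Fintype.ofFinite _

instance {V : Type u} (W : Finset V) : DecidableEq (WiredVertex W) := Classical.decEq _

section Wired

variable {V : Type u} (N : ElectricalNetwork V)

/-- The finite set of neighbors of a vertex. -/
def nbrs (x : V) : Finset V := (N.locallyFinite x).toFinset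

lemma mem_nbrs {x y : V} : y ∈ N.nbrs x ↔ N.graph.Adj x y := by
  simp [nbrs]

lemma eq_of_wiredMk_eq {W : Finset V} {x y : V} (hy : y ∈ W) (h : wiredMk W x = wiredMk W y) :
    x = y :=
  (wiredMk_eq_iff.1 h).resolve_right fun h' => h'.2 hy

lemma wiredMk_ne {W : Finset V} {x y : V} (hy : y ∈ W) (h : x ≠ y) : wiredMk W x ≠ wiredMk W y :=
  fun h' => h (eq_of_wiredMk_eq hy h')

lemma wired_adj_iff {W : Finset V} {x y : V} (hx : x ∈ W) (hy : y ∈ W) :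
    (N.wired W).graph.Adj (wiredMk W x) (wiredMk W y) ↔ N.graph.Adj x y := by
  constructor
  · rintro ⟨-, x', y', h, hx', hy'⟩
    rwa [eq_of_wiredMk_eq hx hx', eq_of_wiredMk_eq hy hy'] at h
  · exact fun h => ⟨wiredMk_ne hy h.ne, x, y, h, rfl, rfl⟩

lemma cond_wired {W : Finset V} {x y : V} (hx : x ∈ W) (hy : y ∈ W) :
    (N.wired W).cond (wiredMk W x) (wiredMk W y) = N.cond x y := by
  by_cases h : N.graph.Adj x y
  · rw [cond_of_adj _ h, cond_of_adj _ ((N.wired_adj_iff hx hy).2 h)]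
    change ∑ᶠ d ∈ dartsBetween N.graph W _ _, N.c d.fst d.snd = _
    have : dartsBetween N.graph W (wiredMk W x) (wiredMk W y) = {⟨(x, y), h⟩} := by
      ext d
      constructor
      · rintro ⟨h1, h2⟩
        exact SimpleGraph.Dart.ext _ _
          (Prod.ext (eq_of_wiredMk_eq hx h1) (eq_of_wiredMk_eq hy h2))
      · rintro rfl
        exact ⟨rfl, rfl⟩
    rw [this, finsum_mem_singleton]
  · rw [cond_of_not_adj _ h, cond_of_not_adj _ fun h' => h ((N.wired_adj_iff hx hy).1 h')]

lemma exists_of_wired_adj {W : Finset V} {x : V} (hx : x ∈ W) {b : WiredVertex W}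
    (h : (N.wired W).graph.Adj (wiredMk W x) b) : ∃ y ∈ N.nbrs x, wiredMk W y = b := by
  obtain ⟨-, x', y', h, hx', hy'⟩ := h
  rw [eq_of_wiredMk_eq hx hx'] at h
  exact ⟨y', N.mem_nbrs.2 h, hy'⟩

/-- When `W` contains the neighbors of `x`, none of them are merged. A sum over the wired graph,
which changes with `W`, becomes a fixed finite sum through which limits pass. -/
lemma sum_wired {W : Finset V} {x : V} (hx : x ∈ W) (hW : N.nbrs x ⊆ W)
    {F : WiredVertex W → ℝ} (hF : ∀ b, ¬ (N.wired W).graph.Adj (wiredMk W x) b → F b = 0) :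
    ∑ b, F b = ∑ y ∈ N.nbrs x, F (wiredMk W y) := by
  classical
  rw [← Finset.sum_image (s := N.nbrs x) (g := wiredMk W) (f := F)
    (fun y _ z hz h => eq_of_wiredMk_eq (hW hz) h)]
  refine (Finset.sum_subset (Finset.subset_univ _) fun b _ hb => hF b fun h => hb ?_).symm
  obtain ⟨y, hy, rfl⟩ := N.exists_of_wired_adj hx h
  exact Finset.mem_image_of_mem _ hy

/-- The images of oriented edges in the wired graph. -/
def wiredPairs (W : Finset V) (E : Finset (V × V)) : Set (WiredVertex W × WiredVertex W) :=
  Prod.map (wiredMk W) (wiredMk W) '' E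

lemma restrictTo_wired {W : Finset V} {E : Finset (V × V)}
    {x y : V} (hx : x ∈ W) (hy : y ∈ W) :
    restrictTo (wiredPairs W E) (N.wired W).cond (wiredMk W x) (wiredMk W y) =
      restrictTo E N.cond x y := by
  refine restrictTo_congr (N.cond_wired hx hy) ⟨fun h b hb => ?_, ?_⟩
  · exact eq_of_wiredMk_eq hy (h _ ⟨(x, b), hb, rfl⟩)
  · rintro h b ⟨e, he, heq⟩
    rw [Prod.map_apply, Prod.mk.injEq] at heq
    have : e.1 = x := eq_of_wiredMk_eq hx heq.1
    rw [← heq.2, h e.2 (this ▸ he)]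

/-- Expresses the energy over the oriented edges of the original network: merging adds conductances
and loops cost nothing. Energies are then visibly unchanged when a function is pulled back to a
finer wired graph. -/
lemma dirichlet_wired (W : Finset V) (h : WiredVertex W → ℝ) :
    dirichlet (N.wired W).cond h h = (∑ᶠ d : N.graph.Dart, N.c d.fst d.snd *
      ((h (wiredMk W d.fst) - h (wiredMk W d.snd)) *
        (h (wiredMk W d.fst) - h (wiredMk W d.snd)))) / 2 := by
  classical
  set f : N.graph.Dart → ℝ := fun d => N.c d.fst d.snd *
      ((h (wiredMk W d.fst) - h (wiredMk W d.snd)) *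
        (h (wiredMk W d.fst) - h (wiredMk W d.snd))) with hf
  let π : N.graph.Dart → WiredVertex W × WiredVertex W :=
    fun d => (wiredMk W d.fst, wiredMk W d.snd)
  -- Only finitely many oriented edges join distinct classes, so the sum over all oriented edges has
  -- finite support.
  have hfin : {d | (π d).1 ≠ (π d).2}.Finite := by
    refine (Set.Finite.biUnion (Set.toFinite {p : WiredVertex W × WiredVertex W | p.1 ≠ p.2})
      (fun p hp => N.finite_dartsBetween W hp)).subset fun d hd => ?_
    exact Set.mem_biUnion (x := π d) hd ⟨rfl, rfl⟩
  have hsupp : Function.support f ⊆ hfin.toFinset := by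
    intro d hd
    rw [Set.Finite.coe_toFinset]
    intro h'
    have h' : wiredMk W d.fst = wiredMk W d.snd := h'
    exact hd (by simp only [hf, h', sub_self, mul_zero])
  rw [dirichlet, finsum_eq_sum_of_support_subset f hsupp,
    ← Finset.sum_fiberwise hfin.toFinset π f, Fintype.sum_prod_type]
  congr 1
  refine Finset.sum_congr rfl fun a _ => Finset.sum_congr rfl fun b _ => ?_
  by_cases hab : a = b
  · subst hab
    rw [sub_self, mul_zero, mul_zero, Finset.sum_eq_zero]
    intro d hd
    rw [Finset.mem_filter, Set.Finite.mem_toFinset] at hd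
    exact absurd (by rw [hd.2]) hd.1
  · have hset : (hfin.toFinset.filter fun d => π d = (a, b) : Set N.graph.Dart) =
        dartsBetween N.graph W a b := by
      ext d
      simp only [Finset.coe_filter, Set.Finite.mem_toFinset, Set.mem_ofPred_eq]
      constructor
      · rintro ⟨-, h2⟩
        exact ⟨congrArg Prod.fst h2, congrArg Prod.snd h2⟩
      · rintro ⟨h1, h2⟩
        have h2 : π d = (a, b) := Prod.ext h1 h2
        exact ⟨by rw [h2]; exact hab, h2⟩
    have hc : (N.wired W).cond a b = ∑ᶠ d ∈ dartsBetween N.graph W a b, N.c d.fst d.snd := by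
      by_cases hadj : (N.wired W).graph.Adj a b
      · exact cond_of_adj _ hadj
      · rw [cond_of_not_adj _ hadj]
        have : dartsBetween N.graph W a b = ∅ := by
          rw [Set.eq_empty_iff_forall_notMem]
          rintro d ⟨h1, h2⟩
          exact hadj ⟨hab, d.fst, d.snd, d.adj, h1, h2⟩
        rw [this, finsum_mem_empty]
    rw [hc, ← hset, finsum_mem_coe_finset, Finset.sum_mul]
    refine Finset.sum_congr rfl fun d hd => ?_
    have hd : π d = (a, b) := (Finset.mem_filter.1 hd).2
    have h1 : wiredMk W d.fst = a := congrArg Prod.fst hd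
    have h2 : wiredMk W d.snd = b := congrArg Prod.snd hd
    simp only [hf, h1, h2]

/-- The projection from a finer to a coarser wired graph. -/
def wiredProj {W W' : Finset V} (h : W ⊆ W') : WiredVertex W' → WiredVertex W :=
  Quotient.lift (wiredMk W) fun _ _ hxy => wiredMk_eq_iff.2
    (hxy.imp_right fun h' => ⟨fun hx => h'.1 (h hx), fun hy => h'.2 (h hy)⟩)

lemma dirichlet_wiredProj {W W' : Finset V} (hW : W ⊆ W') (h : WiredVertex W → ℝ) :
    dirichlet (N.wired W').cond (h ∘ wiredProj hW) (h ∘ wiredProj hW) =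
      dirichlet (N.wired W).cond h h := by
  rw [dirichlet_wired, dirichlet_wired]
  rfl

/-- One term is at most the whole sum over oriented edges, which is twice the energy; keeping a
single orientation costs the factor `2`. -/
lemma sq_sub_le_of_adj {x y : V} (hxy : N.graph.Adj x y) (W : Finset V)
    (h : WiredVertex W → ℝ) :
    (h (wiredMk W x) - h (wiredMk W y)) ^ 2 ≤
      2 / N.c x y * dirichlet (N.wired W).cond h h := by
  have hc := N.c_pos x y hxy
  have hle : N.cond x y * ((h (wiredMk W x) - h (wiredMk W y)) *
      (h (wiredMk W x) - h (wiredMk W y))) ≤ 2 * dirichlet (N.wired W).cond h h := by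
    by_cases hs : wiredMk W x = wiredMk W y
    · rw [hs, sub_self, mul_zero, mul_zero]
      exact mul_nonneg zero_le_two (dirichlet_self_nonneg (N.wired W).cond_nonneg h)
    · have hfin : (Function.support fun d : N.graph.Dart => N.c d.fst d.snd *
          ((h (wiredMk W d.fst) - h (wiredMk W d.snd)) *
            (h (wiredMk W d.fst) - h (wiredMk W d.snd)))).Finite := by
        refine (Set.Finite.biUnion
          (Set.toFinite {p : WiredVertex W × WiredVertex W | p.1 ≠ p.2})
          (fun p hp => N.finite_dartsBetween W hp)).subset fun d hd => ?_
        refine Set.mem_biUnion (x := (wiredMk W d.fst, wiredMk W d.snd)) (fun h' => ?_)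
          ⟨rfl, rfl⟩
        have h' : wiredMk W d.fst = wiredMk W d.snd := h'
        exact hd (by simp only [h', sub_self, mul_zero])
      rw [N.cond_of_adj hxy, dirichlet_wired, mul_div_cancel₀ _ two_ne_zero]
      exact single_le_finsum (⟨(x, y), hxy⟩ : N.graph.Dart) hfin fun d =>
        mul_nonneg (N.c_pos _ _ d.adj).le (mul_self_nonneg _)
  rw [N.cond_of_adj hxy] at hle
  rw [div_mul_eq_mul_div, le_div_iff₀ hc]
  nlinarith

/-- The constant is built along a walk in the original network, hence is uniform in `W`. This is
what keeps the energies of charges bounded. -/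
lemma exists_sq_sub_le (x y : V) : ∃ K, 0 ≤ K ∧ ∀ (W : Finset V) (h : WiredVertex W → ℝ),
    (h (wiredMk W x) - h (wiredMk W y)) ^ 2 ≤ K * dirichlet (N.wired W).cond h h := by
  obtain ⟨p⟩ := N.connected.preconnected x y
  induction p with
  | nil => exact ⟨0, le_rfl, fun W h => by simp⟩
  | @cons x z y hxz p ih =>
    obtain ⟨K, hK, hle⟩ := ih
    refine ⟨2 * (2 / N.c x z) + 2 * K,
      add_nonneg (mul_nonneg zero_le_two (div_nonneg zero_le_two (N.c_pos _ _ hxz).le))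
        (mul_nonneg zero_le_two hK), fun W h => ?_⟩
    have h1 := N.sq_sub_le_of_adj hxz W h
    have h2 := hle W h
    have h3 := sq_nonneg ((h (wiredMk W x) - h (wiredMk W z)) -
      (h (wiredMk W z) - h (wiredMk W y)))
    nlinarith

end Wired

end ElectricalNetwork

/-! ### Infinite-volume limits of energies, Green functions and tree ratios. -/

namespace ElectricalNetwork

open DirectedLaplacian

section Limits

variable {V : Type u} (N : ElectricalNetwork V)

lemma eventually_subset_atTop (s : Finset V) : ∀ᶠ W : Finset V in atTop, s ⊆ W :=
  eventually_ge_atTop s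

lemma eventually_mem_atTop (x : V) : ∀ᶠ W : Finset V in atTop, x ∈ W :=
  (eventually_subset_atTop {x}).mono fun _ h => Finset.singleton_subset_iff.1 h

/-- A unit charge at `x` and a charge `t` at `y`. -/
def charge (W : Finset V) (x y : V) (t : ℝ) : WiredVertex W → ℝ :=
  Pi.single (wiredMk W x) 1 + t • Pi.single (wiredMk W y) 1

lemma charge_dotProduct (W : Finset V) (x y : V) (t : ℝ) (h : WiredVertex W → ℝ) :
    charge W x y t ⬝ᵥ h = h (wiredMk W x) + t * h (wiredMk W y) := by
  rw [charge, add_dotProduct, smul_dotProduct, single_one_dotProduct, single_one_dotProduct,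
    smul_eq_mul]

lemma charge_root {W : Finset V} {r x y : V} (hr : r ∈ W) (hx : x ≠ r) (hy : y ≠ r) (t : ℝ) :
    charge W x y t (wiredMk W r) = 0 := by
  simp [charge, Pi.single_eq_of_ne (wiredMk_ne hr hx).symm,
    Pi.single_eq_of_ne (wiredMk_ne hr hy).symm]

/-- The energies increase with `W`, since potentials pull back to finer wired graphs at equal
energy, and they are bounded by fixed paths to `r`. -/
lemma exists_tendsto_chargeEnergy {r x y : V} (hx : x ≠ r) (hy : y ≠ r) (t : ℝ) :
    ∃ L, Tendsto (fun W : Finset V => chargeEnergy (N.wired W).cond (wiredMk W r)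
      (charge W x y t)) atTop (𝓝 L) := by
  classical
  set q : Finset V → ℝ := fun W => chargeEnergy (N.wired W).cond (wiredMk W r)
    (charge W x y t) with hq
  -- Inserting `r` gives monotonicity on all finite sets; it changes nothing eventually.
  have hmono : Monotone fun W => q (insert r W) := by
    intro W W' hWW'
    have hsub : insert r W ⊆ insert r W' := Finset.insert_subset_insert r hWW'
    refine chargeEnergy_mono (N.wired _).isConductance_cond (N.wired _).isConductance_cond
      (charge_root (Finset.mem_insert_self r W) hx hy t)
      (charge_root (Finset.mem_insert_self r W') hx hy t) (wiredProj hsub) rfl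
      (fun h => ?_) fun h => (N.dirichlet_wiredProj hsub h).le
    rw [charge_dotProduct, charge_dotProduct]
    rfl
  obtain ⟨K, hK, hKx⟩ := N.exists_sq_sub_le x r
  obtain ⟨K', hK', hKy⟩ := N.exists_sq_sub_le y r
  have hbdd : BddAbove (Set.range fun W => q (insert r W)) := by
    refine ⟨2 * K + 2 * t ^ 2 * K', ?_⟩
    rintro _ ⟨W, rfl⟩
    set W' := insert r W
    change q W' ≤ _
    have hc := (N.wired W').isConductance_cond
    have h0 := charge_root (Finset.mem_insert_self r W) hx hy t
    set f := (green (N.wired W').cond (wiredMk W' r)).mulVec (charge W' x y t) with hf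
    have hE : dirichlet (N.wired W').cond f f = q W' := hc.dirichlet_potential_self h0
    have hr : f (wiredMk W' r) = 0 := hc.potential_root h0
    have hv : q W' = f (wiredMk W' x) + t * f (wiredMk W' y) := charge_dotProduct W' x y t f
    have h1 := hKx W' f
    have h2 := hKy W' f
    rw [hr, sub_zero, hE] at h1 h2
    have h3 : 0 ≤ q W' := hE ▸ dirichlet_self_nonneg (N.wired W').cond_nonneg f
    -- The energy equals the charge paired with its potential `f`, and the values of `f` are at most
    -- of the order of the square root of the energy. So `q ^ 2` is bounded by a constant times `q`.
    have h4 : q W' * q W' ≤ (2 * K + 2 * t ^ 2 * K') * q W' := by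
      have h5 := sq_nonneg (f (wiredMk W' x) - t * f (wiredMk W' y))
      have h6 := mul_le_mul_of_nonneg_left h2 (sq_nonneg t)
      calc q W' * q W' = (f (wiredMk W' x) + t * f (wiredMk W' y)) ^ 2 := by rw [← hv, sq]
        _ ≤ 2 * f (wiredMk W' x) ^ 2 + 2 * (t ^ 2 * f (wiredMk W' y) ^ 2) := by nlinarith
        _ ≤ _ := by linarith
    rcases h3.eq_or_lt with h3 | h3
    · rw [← h3]
      positivity
    · exact le_of_mul_le_mul_right h4 h3
  refine ⟨_, (tendsto_atTop_ciSup hmono hbdd).congr' ?_⟩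
  filter_upwards [eventually_mem_atTop r] with W hW
  rw [Finset.insert_eq_of_mem hW]

lemma exists_tendsto_green {r x y : V} (hy : y ≠ r) :
    ∃ L, Tendsto (fun W : Finset V => green (N.wired W).cond (wiredMk W r)
      (wiredMk W x) (wiredMk W y)) atTop (𝓝 L) := by
  by_cases hx : x = r
  · subst hx
    refine ⟨0, tendsto_const_nhds.congr' ?_⟩
    filter_upwards [eventually_mem_atTop x] with W hW
    exact ((N.wired W).isConductance_cond.green_root (wiredMk_ne hW hy)).symm
  -- The value `t = 1` gives the two charges together; `t = 0` gives each charge alone.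
  · obtain ⟨L₁, h₁⟩ := N.exists_tendsto_chargeEnergy hx hy 1
    obtain ⟨L₂, h₂⟩ := N.exists_tendsto_chargeEnergy hx hx 0
    obtain ⟨L₃, h₃⟩ := N.exists_tendsto_chargeEnergy hy hy 0
    refine ⟨_, (((h₁.sub h₂).sub h₃).div_const 2).congr' ?_⟩
    filter_upwards [eventually_mem_atTop r] with W hW
    rw [(N.wired W).isConductance_cond.green_polarization (wiredMk_ne hW hx) (wiredMk_ne hW hy)]
    simp [charge]

/-- In the network wired off `W`, the total weight of the trees oriented towards `r` whose edges
with sources other than `r` are compatible with `E`, relative to the weight of all trees. -/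
def wiredRatio (W : Finset V) (r : V) (E : Finset (V × V)) : ℝ :=
  treeSum (restrictTo (wiredPairs W E) (N.wired W).cond) (wiredMk W r) /
    treeSum (N.wired W).cond (wiredMk W r)

/-- Only the rows of the sources of `E` other than `r` are altered, and at most one transition
survives in each. The ratio is thus a determinant of fixed size in finitely many Green function
values, and determinants are continuous. -/
lemma exists_tendsto_wiredRatio (r : V) (E : Finset (V × V)) :
    ∃ L, Tendsto (fun W : Finset V => N.wiredRatio W r E) atTop (𝓝 L) := by
  classical
  let K : Finset V := (E.image Prod.fst).erase r
  have hK : ∀ i : K, ∃ y, (i.1, y) ∈ E := by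
    rintro ⟨i, hi⟩
    obtain ⟨e, he, rfl⟩ := Finset.mem_image.1 (Finset.mem_of_mem_erase hi)
    exact ⟨e.2, he⟩
  have hKr : ∀ i : K, i.1 ≠ r := fun i => Finset.ne_of_mem_erase i.2
  -- If `E` prescribes several targets for one source, any choice will do: the restricted weight of
  -- the chosen transition is then zero.
  choose t ht using hK
  choose L hL using fun (x : V) (j : K) => N.exists_tendsto_green (x := x) (hKr j)
  have hdet : Tendsto (fun W : Finset V => (Matrix.of fun i j : K =>
      restrictTo E N.cond i (t i) *
        (green (N.wired W).cond (wiredMk W r) (wiredMk W i) (wiredMk W j) -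
          green (N.wired W).cond (wiredMk W r) (wiredMk W (t i)) (wiredMk W j))).det) atTop
      (𝓝 (Matrix.of fun i j : K => restrictTo E N.cond i (t i) * (L i j - L (t i) j)).det) := by
    refine ((continuous_id.matrix_det).tendsto _).comp ?_
    refine tendsto_pi_nhds.2 fun i => tendsto_pi_nhds.2 fun j => ?_
    exact ((hL i j).sub (hL (t i) j)).const_mul _
  refine ⟨_, hdet.congr' ?_⟩
  filter_upwards [eventually_mem_atTop r, eventually_subset_atTop K,
    eventually_subset_atTop (Finset.univ.image t)] with W hr hKW htW
  have hc := (N.wired W).isConductance_cond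
  have hinj : Function.Injective fun i : K => wiredMk W i.1 := fun i j h =>
    Subtype.ext (eq_of_wiredMk_eq (hKW j.2) h)
  have htW' : ∀ i, t i ∈ W := fun i => htW (Finset.mem_image_of_mem _ (Finset.mem_univ i))
  rw [wiredRatio, hc.treeSum_eq_mul_det hinj (r := wiredMk W r),
    mul_div_cancel_left₀ _ (hc.treeSum_ne_zero _)]
  · congr 1
    ext i j
    rw [Matrix.of_apply, Matrix.of_apply, Finset.sum_eq_single (wiredMk W (t i)),
      N.restrictTo_wired (hKW i.2) (htW' i)]
    · intro b _ hb
      rw [restrictTo, if_neg, zero_mul]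
      exact fun h => hb (h _ ⟨(i.1, t i), ht i, rfl⟩).symm
    · simp
  · rintro ⟨i, hi⟩
    exact hKr i (eq_of_wiredMk_eq hr hi)
  · intro v hv hvr y
    rw [restrictTo, if_pos]
    rintro b ⟨e, he, heq⟩
    rw [Prod.map_apply, Prod.mk.injEq] at heq
    have her : e.1 ≠ r := by
      rintro h
      rw [h] at heq
      exact hvr heq.1.symm
    exact absurd ⟨⟨e.1, Finset.mem_erase.2 ⟨her, Finset.mem_image_of_mem _ he⟩⟩, heq.1⟩ hv

/-- The limit of `wiredRatio`. -/
def treeRatio (r : V) (E : Finset (V × V)) : ℝ := (N.exists_tendsto_wiredRatio r E).choose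

lemma tendsto_wiredRatio (r : V) (E : Finset (V × V)) :
    Tendsto (fun W : Finset V => N.wiredRatio W r E) atTop (𝓝 (N.treeRatio r E)) :=
  (N.exists_tendsto_wiredRatio r E).choose_spec

lemma wiredRatio_nonneg (W : Finset V) (r : V) (E : Finset (V × V)) :
    0 ≤ N.wiredRatio W r E := by
  classical
  refine div_nonneg ?_ ((N.wired W).isConductance_cond.treeSum_pos _).le
  rw [treeSum_eq_sum]
  exact Finset.sum_nonneg fun ρ _ => Finset.prod_nonneg fun v _ =>
    restrictTo_nonneg (N.wired W).cond_nonneg _ _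

lemma treeRatio_nonneg (r : V) (E : Finset (V × V)) : 0 ≤ N.treeRatio r E :=
  ge_of_tendsto' (N.tendsto_wiredRatio r E) fun W => N.wiredRatio_nonneg W r E

/-- The limit tree ratios satisfy the invariance equation of the Markov chain tree theorem. -/
lemma sum_treeRatio_mul (x : V) (E : Finset (V × V)) :
    ∑ y ∈ N.nbrs x, N.treeRatio y E * restrictTo E N.cond y x =
      N.treeRatio x E * ∑ y ∈ N.nbrs x, restrictTo E N.cond x y := by
  classical
  refine tendsto_nhds_unique (tendsto_finsetSum _ fun y _ =>
    (N.tendsto_wiredRatio y E).mul_const (restrictTo E N.cond y x)) ?_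
  refine ((N.tendsto_wiredRatio x E).mul_const _).congr' ?_
  filter_upwards [eventually_mem_atTop x, eventually_subset_atTop (N.nbrs x)] with W hx hW
  have hc := (N.wired W).isConductance_cond
  -- The Markov chain tree theorem is applied to the restricted, no longer symmetric, weights.
  have h := sum_treeSum_mul (restrictTo (wiredPairs W E) (N.wired W).cond) (wiredMk W x)
  have hz : ∀ b, ¬ (N.wired W).graph.Adj (wiredMk W x) b →
      restrictTo (wiredPairs W E) (N.wired W).cond (wiredMk W x) b = 0 := fun b hb => by
    rw [restrictTo, cond_of_not_adj _ hb, ite_self]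
  have hz' : ∀ b, ¬ (N.wired W).graph.Adj (wiredMk W x) b →
      restrictTo (wiredPairs W E) (N.wired W).cond b (wiredMk W x) = 0 := fun b hb => by
    rw [restrictTo, cond_of_not_adj _ fun h => hb h.symm, ite_self]
  rw [N.sum_wired hx hW hz, N.sum_wired hx hW fun b hb => by rw [hz' b hb, mul_zero]] at h
  simp only [wiredRatio]
  rw [div_mul_eq_mul_div, eq_comm]
  have h1 : ∑ y ∈ N.nbrs x, restrictTo E N.cond x y = ∑ y ∈ N.nbrs x,
      restrictTo (wiredPairs W E) (N.wired W).cond (wiredMk W x) (wiredMk W y) :=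
    Finset.sum_congr rfl fun y hy => (N.restrictTo_wired hx (hW hy)).symm
  rw [h1, ← h, Finset.sum_div]
  refine Finset.sum_congr rfl fun y hy => ?_
  -- Ratios at different roots share the same denominator, because the unrestricted conductances are
  -- symmetric.
  rw [treeSum_eq_of_symm hc.symm (wiredMk W y) (wiredMk W x), N.restrictTo_wired (hW hy) hx,
    div_mul_eq_mul_div]

/-- A tree oriented towards `r` uses no transition out of `r`, so prescriptions at `r` are
invisible. -/
lemma treeRatio_congr {r : V} {E E' : Finset (V × V)}
    (h : ∀ v, v ≠ r → ∀ y, (v, y) ∈ E ↔ (v, y) ∈ E') : N.treeRatio r E = N.treeRatio r E' := by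
  refine tendsto_nhds_unique (N.tendsto_wiredRatio r E)
    ((N.tendsto_wiredRatio r E').congr' ?_)
  filter_upwards [eventually_mem_atTop r] with W hr
  rw [wiredRatio, wiredRatio]
  congr 1
  refine treeSum_congr fun v hv y => ?_
  have key : ∀ b, (v, b) ∈ wiredPairs W E' ↔ (v, b) ∈ wiredPairs W E := by
    have : ∀ e : V × V, wiredMk W e.1 = v → e.1 ≠ r := by
      rintro e he rfl
      exact hv he.symm
    intro b
    constructor
    · rintro ⟨e, he, heq⟩
      exact ⟨e, (h e.1 (this e (congrArg Prod.fst heq)) e.2).2 he, heq⟩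
    · rintro ⟨e, he, heq⟩
      exact ⟨e, (h e.1 (this e (congrArg Prod.fst heq)) e.2).1 he, heq⟩
  exact restrictTo_congr rfl (forall_congr' fun b => by rw [key])

/-! ### Relation to the finite spanning trees -/

/-- The end points of oriented edges. -/
def dartPairs {G : SimpleGraph V} (B : Finset G.Dart) : Finset (V × V) :=
  B.map ⟨fun d => d.toProd, fun _ _ h => SimpleGraph.Dart.ext _ _ h⟩

lemma mem_dartPairs {G : SimpleGraph V} {B : Finset G.Dart} {x y : V} :
    (x, y) ∈ dartPairs B ↔ ∃ h : G.Adj x y, ⟨(x, y), h⟩ ∈ B := by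
  rw [dartPairs, Finset.mem_map]
  constructor
  · rintro ⟨⟨⟨a, b⟩, hab⟩, hd, h⟩
    cases h
    exact ⟨hab, hd⟩
  · rintro ⟨h, hB⟩
    exact ⟨_, hB, rfl⟩

lemma containsEdges_eq (W : Finset V) (B : Finset N.graph.Dart) :
    N.containsEdges W B = (N.wired W).containsPairs (wiredPairs W (dartPairs B)) := by
  ext T
  constructor
  · rintro h _ ⟨p, hp, rfl⟩
    obtain ⟨d, hd, rfl⟩ := Finset.mem_map.1 hp
    exact h d hd
  · intro h d hd
    exact h _ ⟨d.toProd, Finset.mem_map_of_mem _ hd, rfl⟩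

lemma finiteOrientedWSF_containsEdges {W : Finset V} {r : V} (hr : r ∈ W)
    {B : Finset N.graph.Dart} (hB : ∀ d ∈ B, d.fst ≠ r) :
    (N.wired W).finiteOrientedWSF (wiredMk W r) (N.containsEdges W B) =
      ENNReal.ofReal (N.wiredRatio W r (dartPairs B)) := by
  rw [containsEdges_eq, finiteOrientedWSF_containsPairs]
  · rfl
  · rintro b ⟨p, hp, heq⟩
    obtain ⟨d, hd, rfl⟩ := Finset.mem_map.1 hp
    exact hB d hd (eq_of_wiredMk_eq hr (congrArg Prod.fst heq))

lemma finiteOrientedWSF_containsEdges_of_root (W : Finset V) {r : V}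
    {B : Finset N.graph.Dart} {d : N.graph.Dart} (hd : d ∈ B) (hr : d.fst = r) :
    (N.wired W).finiteOrientedWSF (wiredMk W r) (N.containsEdges W B) = 0 := by
  rw [containsEdges_eq, finiteOrientedWSF_containsPairs_of_root (b := wiredMk W d.snd)]
  exact ⟨d.toProd, Finset.mem_map_of_mem _ hd, by rw [← hr]; rfl⟩

open Classical in
/-- The limit of the probabilities that the oriented spanning trees contain `B`. -/
def wsfProb (r : V) (B : Finset N.graph.Dart) : ENNReal :=
  if ∃ d ∈ B, d.fst = r then 0 else ENNReal.ofReal (N.treeRatio r (dartPairs B))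

lemma tendsto_finiteOrientedWSF (r : V) (B : Finset N.graph.Dart) :
    Tendsto (fun W : Finset V => (N.wired W).finiteOrientedWSF (wiredMk W r)
      (N.containsEdges W B)) atTop (𝓝 (N.wsfProb r B)) := by
  unfold wsfProb
  split_ifs with h
  · obtain ⟨d, hd, hr⟩ := h
    simp only [N.finiteOrientedWSF_containsEdges_of_root _ hd hr]
    exact tendsto_const_nhds
  · push Not at h
    refine (ENNReal.tendsto_ofReal (N.tendsto_wiredRatio r (dartPairs B))).congr' ?_
    filter_upwards [eventually_mem_atTop r] with W hr
    rw [N.finiteOrientedWSF_containsEdges hr h]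

/-- Exhaustions are cofinal among finite sets, so one limit over all finite sets serves every
exhaustion. -/
lemma IsExhaustion.tendsto_atTop {N : ElectricalNetwork V} {W : ℕ → Finset V}
    (hW : N.IsExhaustion W) : Tendsto W atTop atTop :=
  tendsto_atTop_finset_of_monotone (monotone_nat_of_le_succ hW.2.1) hW.2.2

/-! ### Symmetries -/

lemma wiredRatio_map (φ : V ≃ V) (hφ : ∀ x y, N.graph.Adj (φ x) (φ y) ↔ N.graph.Adj x y)
    (hc : ∀ x y, N.graph.Adj x y → N.c (φ x) (φ y) = N.c x y) (W : Finset V) (r : V)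
    (E : Finset (V × V)) :
    N.wiredRatio (W.map φ.toEmbedding) (φ r) (E.map (φ.prodCongr φ).toEmbedding) =
      N.wiredRatio W r E := by
  set W' := W.map φ.toEmbedding with hW'
  have hmem : ∀ x, φ x ∈ W' ↔ x ∈ W := fun x => by
    rw [hW']
    exact Finset.mem_map' φ.toEmbedding
  let e : WiredVertex W ≃ WiredVertex W' := Quotient.congr φ fun x y => by
    change (x = y ∨ (x ∉ W ∧ y ∉ W)) ↔ (φ x = φ y ∨ (φ x ∉ W' ∧ φ y ∉ W'))
    rw [hmem, hmem, φ.injective.eq_iff]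
  have he : ∀ x, e (wiredMk W x) = wiredMk W' (φ x) := fun x => rfl
  have hadj : ∀ a b, (N.wired W').graph.Adj (e a) (e b) ↔ (N.wired W).graph.Adj a b := by
    intro a b
    constructor
    · rintro ⟨hne, x, y, hxy, hx, hy⟩
      refine ⟨fun h => hne (h ▸ rfl), φ.symm x, φ.symm y, ?_, e.injective ?_, e.injective ?_⟩
      · rw [← hφ]
        simpa using hxy
      · rw [he, φ.apply_symm_apply, hx]
      · rw [he, φ.apply_symm_apply, hy]
    · rintro ⟨hne, x, y, hxy, rfl, rfl⟩
      exact ⟨fun h => hne (e.injective h), φ x, φ y, (hφ x y).2 hxy, (he x).symm, (he y).symm⟩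
  have hcond : ∀ a b, (N.wired W').cond (e a) (e b) = (N.wired W).cond a b := by
    intro a b
    by_cases h : (N.wired W).graph.Adj a b
    · rw [cond_of_adj _ h, cond_of_adj _ ((hadj a b).2 h)]
      symm
      refine finsum_mem_eq_of_bijOn (fun d : N.graph.Dart =>
        (⟨(φ d.fst, φ d.snd), (hφ _ _).2 d.adj⟩ : N.graph.Dart)) ⟨?_, ?_, ?_⟩ ?_
      · rintro d ⟨rfl, rfl⟩
        exact ⟨(he _).symm, (he _).symm⟩
      · intro d _ d' _ h
        have h := congrArg SimpleGraph.Dart.toProd h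
        rw [Prod.mk.injEq] at h
        exact SimpleGraph.Dart.ext _ _ (Prod.ext (φ.injective h.1) (φ.injective h.2))
      · rintro d ⟨h1, h2⟩
        refine ⟨⟨(φ.symm d.fst, φ.symm d.snd), ?_⟩, ⟨e.injective ?_, e.injective ?_⟩, ?_⟩
        · rw [← hφ]
          simp
        · rw [he, φ.apply_symm_apply, h1]
        · rw [he, φ.apply_symm_apply, h2]
        · exact SimpleGraph.Dart.ext _ _ (Prod.ext (φ.apply_symm_apply _) (φ.apply_symm_apply _))
      · exact fun d _ => (hc _ _ d.adj).symm
    · rw [cond_of_not_adj _ h, cond_of_not_adj _ fun h' => h ((hadj a b).1 h')]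
  have hpairs : ∀ a b, (e a, e b) ∈ wiredPairs W' (E.map (φ.prodCongr φ).toEmbedding) ↔
      (a, b) ∈ wiredPairs W E := by
    intro a b
    constructor
    · rintro ⟨p, hp, heq⟩
      obtain ⟨q, hq, rfl⟩ := Finset.mem_map.1 hp
      refine ⟨q, hq, Prod.ext (e.injective ?_) (e.injective ?_)⟩
      · exact congrArg Prod.fst heq
      · exact congrArg Prod.snd heq
    · rintro ⟨q, hq, heq⟩
      refine ⟨_, Finset.mem_map_of_mem _ hq, ?_⟩
      have h1 : wiredMk W q.1 = a := congrArg Prod.fst heq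
      have h2 : wiredMk W q.2 = b := congrArg Prod.snd heq
      rw [← h1, ← h2]
      rfl
  have hres : ∀ a b, restrictTo (wiredPairs W' (E.map (φ.prodCongr φ).toEmbedding))
      (N.wired W').cond (e a) (e b) = restrictTo (wiredPairs W E) (N.wired W).cond a b := by
    intro a b
    have key : (∀ b', (e a, b') ∈ wiredPairs W' (E.map (φ.prodCongr φ).toEmbedding) →
        b' = e b) ↔ ∀ b', (a, b') ∈ wiredPairs W E → b' = b := by
      rw [← e.forall_congr_right]
      simp only [hpairs, e.injective.eq_iff]
    exact restrictTo_congr (hcond a b) key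
  rw [wiredRatio, wiredRatio, ← he, ← treeSum_comp_equiv e, ← treeSum_comp_equiv e]
  simp only [hres, hcond]

/-- An automorphism carries the network wired off `W` to the one wired off the image of `W`, and
these images are again cofinal. -/
lemma treeRatio_map (φ : V ≃ V) (hφ : ∀ x y, N.graph.Adj (φ x) (φ y) ↔ N.graph.Adj x y)
    (hc : ∀ x y, N.graph.Adj x y → N.c (φ x) (φ y) = N.c x y) (r : V) (E : Finset (V × V)) :
    N.treeRatio (φ r) (E.map (φ.prodCongr φ).toEmbedding) = N.treeRatio r E := by
  have hmap : Tendsto (fun W : Finset V => W.map φ.toEmbedding) atTop atTop := by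
    refine tendsto_atTop_atTop.2 fun s => ⟨s.map φ.symm.toEmbedding, fun W hW x hx => ?_⟩
    refine Finset.mem_map.2 ⟨φ.symm x, hW (Finset.mem_map_of_mem _ hx), ?_⟩
    exact φ.apply_symm_apply x
  refine tendsto_nhds_unique ((N.tendsto_wiredRatio _ _).comp hmap)
    ((N.tendsto_wiredRatio r E).congr fun W => ?_)
  exact (N.wiredRatio_map φ hφ hc W r E).symm

end Limits

end ElectricalNetwork

/-! ### Existence and uniqueness of the oriented wired spanning forest. -/

namespace ElectricalNetwork

section Law

variable {V : Type u}

lemma countable_vertices (N : ElectricalNetwork V) : Countable V := by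
  obtain ⟨r⟩ := N.connected.nonempty
  let B : ℕ → Set V := fun n => n.rec {r} fun _ s => ⋃ x ∈ s, N.graph.neighborSet x
  have hB : ∀ n, (B n).Countable := by
    intro n
    induction n with
    | zero => exact Set.countable_singleton r
    | succ n ih => exact ih.biUnion fun x _ => (N.locallyFinite x).countable
  have hmem : ∀ {a x : V} (_ : N.graph.Walk a x), ∀ n, a ∈ B n → ∃ m, x ∈ B m := by
    intro a x p
    induction p with
    | nil => exact fun n hn => ⟨n, hn⟩
    | cons h p ih => exact fun n hn => ih (n + 1) (Set.mem_biUnion hn h)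
  have huniv : (⋃ n, B n) = Set.univ := by
    refine Set.eq_univ_of_forall fun x => Set.mem_iUnion.2 ?_
    obtain ⟨p⟩ := N.connected.preconnected r x
    exact hmem p 0 rfl
  rw [← Set.countable_univ_iff, ← huniv]
  exact Set.countable_iUnion hB

variable (N : ElectricalNetwork V)

lemma countable_dart [Countable V] {G : SimpleGraph V} : Countable G.Dart :=
  Function.Injective.countable (f := fun d : G.Dart => d.toProd)
    fun _ _ h => SimpleGraph.Dart.ext _ _ h

/-- Finite unions of walks from one vertex are connected. Without an exhaustion the defining limits
would be vacuous and uniqueness would fail. -/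
lemma exists_isExhaustion : ∃ W, N.IsExhaustion W := by
  classical
  have := N.countable_vertices
  obtain ⟨r⟩ := N.connected.nonempty
  have : Nonempty V := ⟨r⟩
  obtain ⟨f, hf⟩ := exists_surjective_nat V
  let p : ∀ n, N.graph.Walk r (f n) := fun n => (N.connected.preconnected r (f n)).some
  let W : ℕ → Finset V := fun n =>
    n.rec (p 0).support.toFinset fun n s => s ∪ (p (n + 1)).support.toFinset
  have hsupp : ∀ n, (N.graph.induce ((p n).support.toFinset : Set V)).Connected := by
    intro n
    have := (p n).connected_induce_support
    rwa [← List.coe_toFinset] at this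
  have hr : ∀ n, r ∈ W n := by
    intro n
    induction n with
    | zero => exact List.mem_toFinset.2 (p 0).start_mem_support
    | succ n ih => exact Finset.mem_union_left _ ih
  refine ⟨W, fun n => ?_, fun n => Finset.subset_union_left, fun x => ?_⟩
  · induction n with
    | zero => exact hsupp 0
    | succ n ih =>
      change (N.graph.induce ((W n ∪ (p (n + 1)).support.toFinset : Finset V) : Set V)).Connected
      rw [Finset.coe_union]
      exact SimpleGraph.induce_union_connected ih.preconnected (hsupp (n + 1)).preconnected
        ⟨r, hr n, List.mem_toFinset.2 (p (n + 1)).start_mem_support⟩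
  · obtain ⟨n, rfl⟩ := hf x
    refine ⟨n, ?_⟩
    cases n with
    | zero => exact List.mem_toFinset.2 (p 0).end_mem_support
    | succ n => exact Finset.mem_union_right _ (List.mem_toFinset.2 (p (n + 1)).end_mem_support)

lemma measurableSet_superset {α : Type*} (B : Finset α) :
    MeasurableSet {F : Set α | (B : Set α) ⊆ F} := by
  have : {F : Set α | (B : Set α) ⊆ F} = ⋂ d ∈ B, {F : Set α | d ∈ F} := by
    ext F
    simp only [Set.mem_iInter]
    rfl
  rw [this]
  exact Finset.measurableSet_biInter B fun d _ => measurableSet_mem d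

/-- A finite measure on subsets is determined by the inclusion probabilities of finite sets. -/
lemma measure_ext_of_superset {α : Type*} {μ ν : Measure (Set α)} [IsFiniteMeasure μ]
    (h : ∀ B : Finset α, μ {F | (B : Set α) ⊆ F} = ν {F | (B : Set α) ⊆ F}) : μ = ν := by
  classical
  refine ext_of_generate_finite (Set.range fun B : Finset α => {F : Set α | (B : Set α) ⊆ F})
    ?_ ?_ ?_ ?_
  · refine le_antisymm ?_ (MeasurableSpace.generateFrom_le ?_)
    · have key : ∀ m : MeasurableSpace (Set α), (∀ a, MeasurableSet[m] {F | a ∈ F}) →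
          Set.instMeasurableSpace ≤ m := by
        intro m hm s hs
        exact (@measurable_set_iff α (Set α) m id).2
          (fun a => (@measurableSet_setOfPred (Set α) m _).1 (hm a)) hs
      refine key _ fun a => MeasurableSpace.measurableSet_generateFrom ⟨{a}, ?_⟩
      ext F
      simp
    · rintro _ ⟨B, rfl⟩
      exact measurableSet_superset B
  · rintro _ ⟨B, rfl⟩ _ ⟨B', rfl⟩ -
    refine ⟨B ∪ B', ?_⟩
    ext F
    simp [Set.union_subset_iff]
  · rintro _ ⟨B, rfl⟩
    exact h B
  · simpa using h ∅

lemma IsOrientedWSF.apply {N : ElectricalNetwork V} {r : V} {ν : Measure (Set N.graph.Dart)}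
    (hν : N.IsOrientedWSF r ν) (B : Finset N.graph.Dart) :
    ν {F | (B : Set N.graph.Dart) ⊆ F} = N.wsfProb r B := by
  obtain ⟨W, hW⟩ := N.exists_isExhaustion
  exact tendsto_nhds_unique (hν.2 W hW B)
    ((N.tendsto_finiteOrientedWSF r B).comp hW.tendsto_atTop)

lemma isOrientedWSF_of_apply {r : V} {ν : Measure (Set N.graph.Dart)} [IsProbabilityMeasure ν]
    (h : ∀ B : Finset N.graph.Dart, ν {F | (B : Set N.graph.Dart) ⊆ F} = N.wsfProb r B) :
    N.IsOrientedWSF r ν := by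
  refine ⟨inferInstance, fun W hW B => ?_⟩
  rw [h]
  exact (N.tendsto_finiteOrientedWSF r B).comp hW.tendsto_atTop

open Classical in
/-- The lift of an oriented subgraph of the wired graph, by its indicator function. -/
def liftIndicator (W : Finset V) (T : Set (N.wired W).graph.Dart) : N.graph.Dart → Bool :=
  fun d => decide (∃ e ∈ T, e.fst = wiredMk W d.fst ∧ e.snd = wiredMk W d.snd)

lemma measurable_liftIndicator (W : Finset V) : Measurable (N.liftIndicator W) := by
  have := countable_dart (G := (N.wired W).graph)
  have : Finite (N.wired W).graph.Dart := Finite.of_injective (fun d => d.toProd)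
    fun d e h => SimpleGraph.Dart.ext _ _ h
  exact fun s _ => (Set.toFinite _).measurableSet

/-- The lifts of the finite spanning trees, as random indicator functions. -/
def liftLaw (r : V) (W : Finset V) : ProbabilityMeasure (N.graph.Dart → Bool) :=
  ⟨((N.wired W).finiteOrientedWSF (wiredMk W r)).map (N.liftIndicator W),
    Measure.isProbabilityMeasure_map (N.measurable_liftIndicator W).aemeasurable⟩

lemma isClopen_forall_eq_true {α : Type*} (B : Finset α) :
    IsClopen {f : α → Bool | ∀ d ∈ B, f d = true} := by
  have : {f : α → Bool | ∀ d ∈ B, f d = true} = ⋂ d ∈ B, (fun f => f d) ⁻¹' {true} := by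
    ext f
    simp
  rw [this]
  exact isClopen_biInter_finset fun d _ => (isClopen_discrete {true}).preimage
    (continuous_apply d)

/-- Probability measures on the compact product space form a compact space, so the lifted finite
laws converge along an ultrafilter finer than `atTop`. Inclusion events of finite sets are clopen,
hence their probabilities pass to the limit. -/
lemma exists_isOrientedWSF (r : V) : ∃ ν, N.IsOrientedWSF r ν := by
  have := N.countable_vertices
  have := countable_dart (G := N.graph)
  let u : Ultrafilter (ProbabilityMeasure (N.graph.Dart → Bool)) :=
    (Ultrafilter.of (atTop : Filter (Finset V))).map (N.liftLaw r)
  have hu : Tendsto (N.liftLaw r) (Ultrafilter.of (atTop : Filter (Finset V))) (𝓝 u.lim) :=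
    u.le_nhds_lim
  have hval : ∀ B : Finset N.graph.Dart,
      (u.lim : Measure (N.graph.Dart → Bool)) {f | ∀ d ∈ B, f d = true} = N.wsfProb r B := by
    intro B
    refine tendsto_nhds_unique
      (ProbabilityMeasure.tendsto_measure_of_null_frontier_of_tendsto' hu
        (by simp [(isClopen_forall_eq_true B).frontier_eq]))
      (((N.tendsto_finiteOrientedWSF r B).mono_left (Ultrafilter.of_le _)).congr fun W => ?_)
    change _ = ((N.wired W).finiteOrientedWSF (wiredMk W r)).map (N.liftIndicator W) _
    rw [Measure.map_apply (N.measurable_liftIndicator W)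
      (isClopen_forall_eq_true B).isOpen.measurableSet]
    congr 1
    ext T
    simp [containsEdges, liftIndicator]
  have hmeas : Measurable fun f : N.graph.Dart → Bool => {d | f d = true} :=
    measurable_set_iff.2 fun d => by
      change Measurable fun f : N.graph.Dart → Bool => f d = true
      exact (measurable_pi_apply d : Measurable fun f : N.graph.Dart → Bool => f d).eq_const true
  refine ⟨(u.lim : Measure (N.graph.Dart → Bool)).map fun f => {d | f d = true}, ?_⟩
  have := Measure.isProbabilityMeasure_map (μ := (u.lim : Measure (N.graph.Dart → Bool)))
    hmeas.aemeasurable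
  refine N.isOrientedWSF_of_apply fun B => ?_
  rw [Measure.map_apply hmeas (measurableSet_superset B), ← hval]
  rfl

/-- The oriented wired spanning forest of a network exists and is unique. -/
theorem existsUnique_isOrientedWSF (r : V) : ∃! ν, N.IsOrientedWSF r ν := by
  obtain ⟨ν, hν⟩ := N.exists_isOrientedWSF r
  refine ⟨ν, hν, fun ν' hν' => ?_⟩
  have := hν'.1
  exact measure_ext_of_superset fun B => (hν'.apply B).trans (hν.apply B).symm

end Law

end ElectricalNetwork

/-! ### Outdegrees in the forest: one away from the root, zero at the root. -/

lemma DirectedLaplacian.treeSum_eq_zero {U : Type*} [Fintype U] [DecidableEq U]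
    {w : U → U → ℝ} {r x : U} (hx : x ≠ r) (h : ∀ b, w x b = 0) : treeSum w r = 0 := by
  classical
  rw [treeSum_eq_sum]
  exact Finset.sum_eq_zero fun ρ _ => Finset.prod_eq_zero (i := x) (by simp [hx]) (h _)

/-- Sorts the trees by their unique edge out of `x`. -/
lemma DirectedLaplacian.sum_treeSum_restrictTo {U : Type*} [Fintype U] [DecidableEq U]
    (w : U → U → ℝ) {r x : U} (hx : x ≠ r) :
    ∑ b, treeSum (ElectricalNetwork.restrictTo {(x, b)} w) r = treeSum w r := by
  classical
  simp only [treeSum_eq_sum]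
  rw [Finset.sum_comm]
  refine Finset.sum_congr rfl fun ρ _ => ?_
  rw [Finset.sum_eq_single (ρ x)]
  · refine Finset.prod_congr rfl fun v _ => ?_
    rw [ElectricalNetwork.restrictTo, if_pos]
    rintro b h
    rw [Set.mem_singleton_iff, Prod.mk.injEq] at h
    rw [h.1, h.2]
  · intro b _ hb
    refine Finset.prod_eq_zero (i := x) (by simp [hx]) ?_
    rw [ElectricalNetwork.restrictTo, if_neg]
    exact fun h => hb (h b rfl)
  · simp

namespace ElectricalNetwork

open DirectedLaplacian

section Outdegree

variable {V : Type u} (N : ElectricalNetwork V)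

lemma treeRatio_eq_zero {r x y : V} {E : Finset (V × V)} (hx : x ≠ r) (hxy : (x, y) ∈ E)
    (h : ¬ N.graph.Adj x y ∨ ∃ z, z ≠ y ∧ (x, z) ∈ E) : N.treeRatio r E = 0 := by
  refine tendsto_nhds_unique (N.tendsto_wiredRatio r E) (tendsto_const_nhds.congr' ?_)
  filter_upwards [eventually_mem_atTop r, eventually_mem_atTop x, eventually_mem_atTop y]
    with W hr hxW hyW
  rw [wiredRatio, treeSum_eq_zero (wiredMk_ne hr hx), zero_div]
  intro b
  by_cases hb : b = wiredMk W y
  · subst hb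
    rcases h with h | ⟨z, hz, hxz⟩
    · rw [restrictTo, cond_of_not_adj _ fun h' => h ((N.wired_adj_iff hxW hyW).1 h'), ite_self]
    · rw [restrictTo, if_neg]
      exact fun h => wiredMk_ne hyW hz (h _ ⟨_, hxz, rfl⟩)
  · rw [restrictTo, if_neg]
    exact fun h => hb (h _ ⟨_, hxy, rfl⟩).symm

lemma sum_treeRatio_singleton {r x : V} (hx : x ≠ r) :
    ∑ y ∈ N.nbrs x, N.treeRatio r {(x, y)} = 1 := by
  refine tendsto_nhds_unique (tendsto_finsetSum _ fun y _ => N.tendsto_wiredRatio r {(x, y)})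
    (tendsto_const_nhds.congr' ?_)
  filter_upwards [eventually_mem_atTop r, eventually_mem_atTop x,
    eventually_subset_atTop (N.nbrs x)] with W hr hxW hW
  have hc := (N.wired W).isConductance_cond
  have hxr : wiredMk W x ≠ wiredMk W r := wiredMk_ne hr hx
  have h := sum_treeSum_restrictTo (N.wired W).cond hxr
  rw [N.sum_wired hxW hW] at h
  · simp only [wiredRatio]
    rw [← Finset.sum_div, eq_div_iff (hc.treeSum_ne_zero _), one_mul, ← h]
    refine Finset.sum_congr rfl fun y _ => ?_
    rw [wiredPairs, Finset.coe_singleton, Set.image_singleton]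
    rfl
  · intro b hb
    refine treeSum_eq_zero hxr fun b' => ?_
    by_cases hbb : b' = b
    · rw [hbb, restrictTo, cond_of_not_adj _ hb, ite_self]
    · rw [restrictTo, if_neg]
      exact fun h => hbb (h b rfl).symm

lemma tsum_neighborSet (x : V) (F : V → ENNReal) :
    ∑' y : N.graph.neighborSet x, F y = ∑ y ∈ N.nbrs x, F y := by
  have h : N.graph.neighborSet x = (N.nbrs x : Set V) := by
    ext y
    exact N.mem_nbrs.symm
  rw [tsum_subtype, h, ← tsum_subtype, Finset.tsum_subtype']

variable {N}

lemma IsOrientedWSF.ae_root {r : V} {ν : Measure (Set N.graph.Dart)}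
    (hν : N.IsOrientedWSF r ν) (y : N.graph.neighborSet r) :
    ∀ᵐ F ∂ν, (⟨(r, y), y.2⟩ : N.graph.Dart) ∉ F := by
  have h := hν.apply {⟨(r, y), y.2⟩}
  rw [wsfProb, if_pos ⟨_, Finset.mem_singleton_self _, rfl⟩] at h
  simpa [ae_iff] using h

lemma IsOrientedWSF.ae_not_mem_pair {r : V} {ν : Measure (Set N.graph.Dart)}
    (hν : N.IsOrientedWSF r ν) {x : V} (hx : x ≠ r) {y z : N.graph.neighborSet x}
    (hyz : y ≠ z) :
    ν {F | (⟨(x, y), y.2⟩ : N.graph.Dart) ∈ F ∧ (⟨(x, z), z.2⟩ : N.graph.Dart) ∈ F} = 0 := by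
  classical
  have h := hν.apply {⟨(x, y), y.2⟩, ⟨(x, z), z.2⟩}
  rw [wsfProb, if_neg (by simpa using hx), N.treeRatio_eq_zero (x := x) (y := y) hx,
    ENNReal.ofReal_zero] at h
  · rw [← h]
    congr 1
    ext F
    simp [Set.insert_subset_iff]
  · exact mem_dartPairs.2 ⟨y.2, by simp⟩
  · exact Or.inr ⟨z, fun h => hyz (Subtype.ext h.symm), mem_dartPairs.2 ⟨z.2, by simp⟩⟩

/-- The events that `x` points to a given neighbor overlap in null sets, and their probabilities add
up to one. The degree of `x` is finite, so no mass is lost in the limit. -/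
lemma IsOrientedWSF.ae_existsUnique {r : V} {ν : Measure (Set N.graph.Dart)}
    (hν : N.IsOrientedWSF r ν) {x : V} (hx : x ≠ r) :
    ∀ᵐ F ∂ν, ∃! y : N.graph.neighborSet x, (⟨(x, y), y.2⟩ : N.graph.Dart) ∈ F := by
  classical
  have := hν.1
  have hfin : Finite (N.graph.neighborSet x) := (N.locallyFinite x).to_subtype
  let A : N.graph.neighborSet x → Set (Set N.graph.Dart) := fun y =>
    {F | (⟨(x, y), y.2⟩ : N.graph.Dart) ∈ F}
  have hA : ∀ y, ν (A y) = ENNReal.ofReal (N.treeRatio r {(x, y.1)}) := by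
    intro y
    have h := hν.apply {⟨(x, y), y.2⟩}
    rw [wsfProb, if_neg (by simpa using hx)] at h
    refine Eq.trans ?_ h
    congr 1
    ext F
    simp [A]
  have hunion : ν (⋃ y, A y) = 1 := by
    rw [measure_iUnion₀]
    · simp only [hA]
      rw [N.tsum_neighborSet x fun y => ENNReal.ofReal (N.treeRatio r {(x, y)}),
        ← ENNReal.ofReal_sum_of_nonneg fun y _ => N.treeRatio_nonneg _ _,
        N.sum_treeRatio_singleton hx, ENNReal.ofReal_one]
    · exact fun y z hyz => hν.ae_not_mem_pair hx hyz
    · exact fun y => (measurableSet_mem _).nullMeasurableSet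
  have h1 : ∀ᵐ F ∂ν, F ∈ ⋃ y, A y := by
    rw [← prob_compl_eq_zero_iff (MeasurableSet.iUnion fun y => measurableSet_mem _)] at hunion
    exact hunion
  have h2 : ∀ᵐ F ∂ν, ∀ y z : N.graph.neighborSet x, y ≠ z → ¬ (F ∈ A y ∧ F ∈ A z) := by
    refine ae_all_iff.2 fun y => ae_all_iff.2 fun z => ?_
    by_cases hyz : y = z
    · simp [hyz]
    · have h := hν.ae_not_mem_pair hx hyz
      have h' : ∀ᵐ F ∂ν, ¬ (F ∈ A y ∧ F ∈ A z) := by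
        rw [ae_iff]
        simpa [A] using h
      exact h'.mono fun F hF _ => hF
  filter_upwards [h1, h2] with F hF1 hF2
  obtain ⟨y, hy⟩ := Set.mem_iUnion.1 hF1
  refine ⟨y, hy, fun z hz => ?_⟩
  by_contra hne
  exact hF2 z y hne ⟨hz, hy⟩

end Outdegree

/-! ### The forest plus one edge as a law on rotor configurations. -/

section Plus

variable {V : Type u} [MeasurableSpace V] [DiscreteMeasurableSpace V] (N : ElectricalNetwork V)

lemma measurable_toSubgraph {G : SimpleGraph V} :
    Measurable (RotorConfig.toSubgraph : RotorConfig G → Set G.Dart) := by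
  refine measurable_set_iff.2 fun d => ?_
  change Measurable fun ρ : RotorConfig G => d.snd = ρ d.fst
  exact (measurable_subtype_coe.comp (measurable_pi_apply d.fst)).const_eq d.snd

/-- The neighbor of `x` that an oriented subgraph points to, if it is unique, and a default
neighbor otherwise. -/
def toRotor {G : SimpleGraph V} (ρ₀ : RotorConfig G) (F : Set G.Dart) : RotorConfig G := fun x =>
  open Classical in
  if h : ∃! y : G.neighborSet x, (⟨(x, y), y.2⟩ : G.Dart) ∈ F then h.choose else ρ₀ x

omit [MeasurableSpace V] [DiscreteMeasurableSpace V] in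
lemma toRotor_eq {G : SimpleGraph V} (ρ₀ : RotorConfig G) {F : Set G.Dart} {x : V}
    {y : G.neighborSet x} (hy : (⟨(x, y), y.2⟩ : G.Dart) ∈ F)
    (hu : ∀ z : G.neighborSet x, (⟨(x, z), z.2⟩ : G.Dart) ∈ F → z = y) :
    toRotor ρ₀ F x = y := by
  have h : ∃! y : G.neighborSet x, (⟨(x, y), y.2⟩ : G.Dart) ∈ F := ⟨y, hy, hu⟩
  rw [toRotor, dif_pos h]
  exact hu _ h.choose_spec.1

omit [MeasurableSpace V] [DiscreteMeasurableSpace V] in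
lemma toRotor_toSubgraph {G : SimpleGraph V} (ρ₀ ρ : RotorConfig G) :
    toRotor ρ₀ ρ.toSubgraph = ρ :=
  funext fun _ => toRotor_eq ρ₀ rfl fun _ hz => Subtype.ext hz

omit [MeasurableSpace V] [DiscreteMeasurableSpace V] in
lemma toSubgraph_toRotor {G : SimpleGraph V} (ρ₀ : RotorConfig G) {F : Set G.Dart}
    (hF : ∀ x, ∃! y : G.neighborSet x, (⟨(x, y), y.2⟩ : G.Dart) ∈ F) :
    (toRotor ρ₀ F).toSubgraph = F := by
  ext ⟨⟨x, z⟩, hd⟩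
  obtain ⟨y, hy, hu⟩ := hF x
  change z = toRotor ρ₀ F x ↔ _
  rw [toRotor_eq ρ₀ hy hu]
  constructor
  · rintro rfl
    exact hy
  · exact fun h => congrArg Subtype.val (hu ⟨z, hd⟩ h)

omit [MeasurableSpace V] [DiscreteMeasurableSpace V] in
lemma measurable_existsUnique [Countable V] {G : SimpleGraph V} (x : V) :
    Measurable fun F : Set G.Dart =>
      ∃! y : G.neighborSet x, (⟨(x, y), y.2⟩ : G.Dart) ∈ F := by
  unfold ExistsUnique
  fun_prop

omit [MeasurableSpace V] [DiscreteMeasurableSpace V] in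
lemma toRotor_eq_iff {G : SimpleGraph V} (ρ₀ : RotorConfig G) (F : Set G.Dart) (x : V)
    (y : G.neighborSet x) : toRotor ρ₀ F x = y ↔
      ((∃! y : G.neighborSet x, (⟨(x, y), y.2⟩ : G.Dart) ∈ F) ∧ (⟨(x, y), y.2⟩ : G.Dart) ∈ F) ∨
      (¬ (∃! y : G.neighborSet x, (⟨(x, y), y.2⟩ : G.Dart) ∈ F) ∧ ρ₀ x = y) := by
  by_cases h : ∃! y : G.neighborSet x, (⟨(x, y), y.2⟩ : G.Dart) ∈ F
  · obtain ⟨z, hz, hu⟩ := h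
    have h : ∃! y : G.neighborSet x, (⟨(x, y), y.2⟩ : G.Dart) ∈ F := ⟨z, hz, hu⟩
    rw [toRotor_eq ρ₀ hz hu]
    simp only [h, true_and, not_true_eq_false, false_and, or_false]
    exact ⟨fun e => e ▸ hz, fun hy => (hu y hy).symm⟩
  · rw [toRotor, dif_neg h]
    simp only [h, false_and, not_false_eq_true, true_and, false_or]

omit [DiscreteMeasurableSpace V] in
lemma measurable_toRotor [Countable V] {G : SimpleGraph V} (ρ₀ : RotorConfig G) :
    Measurable (toRotor ρ₀ : Set G.Dart → RotorConfig G) := by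
  refine measurable_pi_lambda _ fun x => measurable_to_countable' fun y => ?_
  have : (fun F => toRotor ρ₀ F x) ⁻¹' {y} = {F : Set G.Dart | toRotor ρ₀ F x = y} := rfl
  rw [this]
  simp only [toRotor_eq_iff]
  refine measurableSet_setOfPred.2 ?_
  have := measurable_existsUnique (G := G) x
  fun_prop

/-- The total conductance of the edges at a vertex. -/
def totalCond (x : V) : ℝ := ∑ y ∈ N.nbrs x, N.cond x y

omit [MeasurableSpace V] [DiscreteMeasurableSpace V] in
lemma mu_eq (x : V) (y : N.graph.neighborSet x) : N.mu x y = N.cond x y / N.totalCond x := by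
  rw [mu, cond_of_adj _ y.2, finsum_set_coe_eq_finsum_mem (s := N.graph.neighborSet x)
    (f := fun z => N.c x z), totalCond, finsum_mem_eq_finite_toFinset_sum _ (N.locallyFinite x)]
  congr 1
  exact Finset.sum_congr rfl fun z hz => (N.cond_of_adj (N.mem_nbrs.1 hz)).symm

lemma lintegral_muMeasure (x : V) (f : N.graph.neighborSet x → ENNReal) :
    ∫⁻ y, f y ∂N.muMeasure x = ∑' y, ENNReal.ofReal (N.mu x y) * f y := by
  have := N.countable_vertices
  have hf : Measurable f := Measurable.of_discrete
  rw [muMeasure, lintegral_sum_measure]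
  simp only [lintegral_smul_measure, lintegral_dirac' _ hf, smul_eq_mul]

instance (x : V) : SFinite (N.muMeasure x) := by
  have := N.countable_vertices
  unfold muMeasure
  infer_instance

lemma measurable_insertEdge (r : V) :
    Measurable fun q : Set N.graph.Dart × N.graph.neighborSet r =>
      insert (⟨(r, q.2.1), q.2.2⟩ : N.graph.Dart) q.1 := by
  have := N.countable_vertices
  refine measurable_set_iff.2 fun d => ?_
  change Measurable fun q : Set N.graph.Dart × N.graph.neighborSet r =>
    d = (⟨(r, q.2.1), q.2.2⟩ : N.graph.Dart) ∨ d ∈ q.1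
  refine Measurable.or ?_ ((measurable_set_mem d).comp measurable_fst)
  exact (Measurable.of_discrete (f := fun y : N.graph.neighborSet r =>
    d = (⟨(r, y.1), y.2⟩ : N.graph.Dart))).comp measurable_snd

lemma plusEdge_apply (r : V) {ν : Measure (Set N.graph.Dart)} [SFinite ν]
    {A : Set (Set N.graph.Dart)} (hA : MeasurableSet A) :
    N.plusEdge r ν A = ∑' y : N.graph.neighborSet r, ENNReal.ofReal (N.mu r y) *
      ν {F | insert (⟨(r, y), y.2⟩ : N.graph.Dart) F ∈ A} := by
  rw [plusEdge, Measure.map_apply (N.measurable_insertEdge r) hA,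
    Measure.prod_apply_symm (N.measurable_insertEdge r hA), lintegral_muMeasure]
  rfl

variable {N}

lemma IsOrientedWSF.ae_plusEdge {r : V} {ν : Measure (Set N.graph.Dart)}
    (hν : N.IsOrientedWSF r ν) : ∀ᵐ F ∂N.plusEdge r ν,
      ∀ x, ∃! y : N.graph.neighborSet x, (⟨(x, y), y.2⟩ : N.graph.Dart) ∈ F := by
  have := N.countable_vertices
  have := hν.1
  rw [plusEdge, ae_map_iff (N.measurable_insertEdge r).aemeasurable
    (measurableSet_setOfPred.2 (Measurable.forall fun x => measurable_existsUnique x))]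
  have h : ∀ᵐ F ∂ν, (∀ y : N.graph.neighborSet r, (⟨(r, y), y.2⟩ : N.graph.Dart) ∉ F) ∧
      ∀ x, x ≠ r → ∃! y : N.graph.neighborSet x, (⟨(x, y), y.2⟩ : N.graph.Dart) ∈ F := by
    refine (ae_all_iff.2 fun y => hν.ae_root y).and (ae_all_iff.2 fun x => ?_)
    by_cases hx : x = r
    · exact ae_of_all _ fun F h => absurd hx h
    · exact (hν.ae_existsUnique hx).mono fun F hF _ => hF
  filter_upwards [Measure.quasiMeasurePreserving_fst.ae h] with q hq x
  by_cases hx : x = r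
  · subst hx
    refine ⟨q.2, Or.inl rfl, fun z hz => ?_⟩
    rcases hz with hz | hz
    · exact Subtype.ext (congrArg (fun d : N.graph.Dart => d.snd) hz)
    · exact absurd hz (hq.1 z)
  · obtain ⟨y, hy, hu⟩ := hq.2 x hx
    refine ⟨y, Or.inr hy, fun z hz => ?_⟩
    rcases hz with hz | hz
    · exact absurd (congrArg (fun d : N.graph.Dart => d.fst) hz) hx
    · exact hu z hz

/-- The forest plus one edge is the subgraph of a rotor configuration with a unique law. -/
lemma IsOrientedWSF.existsUnique_rotorLaw {r : V} {ν : Measure (Set N.graph.Dart)}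
    (hν : N.IsOrientedWSF r ν) (ρ₀ : RotorConfig N.graph) :
    ∃! π : Measure (RotorConfig N.graph), π.map RotorConfig.toSubgraph = N.plusEdge r ν := by
  have := N.countable_vertices
  -- `toRotor ρ₀` is a left inverse of `RotorConfig.toSubgraph`, which gives uniqueness. It is also
  -- a right inverse on almost every subgraph, which gives existence.
  refine ⟨(N.plusEdge r ν).map (toRotor ρ₀), ?_, fun π hπ => ?_⟩
  · change Measure.map _ _ = _
    rw [Measure.map_map measurable_toSubgraph (measurable_toRotor ρ₀)]
    refine Eq.trans (Measure.map_congr ?_) Measure.map_id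
    exact hν.ae_plusEdge.mono fun F hF => toSubgraph_toRotor ρ₀ hF
  · rw [← hπ, Measure.map_map (measurable_toRotor ρ₀) measurable_toSubgraph]
    have : toRotor ρ₀ ∘ RotorConfig.toSubgraph = (id : RotorConfig N.graph → _) :=
      funext fun ρ => toRotor_toSubgraph ρ₀ ρ
    rw [this, Measure.map_id]

/-- The rotor configurations with `ρ e.1 = e.2` for all `e ∈ E`. -/
def rotorCylinder {G : SimpleGraph V} (E : Finset (V × V)) : Set (RotorConfig G) :=
  {ρ | ∀ e ∈ E, (ρ e.1 : V) = e.2}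

lemma measurableSet_rotorCylinder {G : SimpleGraph V} (E : Finset (V × V)) :
    MeasurableSet (rotorCylinder E : Set (RotorConfig G)) := by
  have : (rotorCylinder E : Set (RotorConfig G)) = ⋂ e ∈ E, {ρ | (ρ e.1 : V) = e.2} := by
    ext ρ
    simp [rotorCylinder]
  rw [this]
  refine Finset.measurableSet_biInter E fun e _ => measurableSet_setOfPred.2 ?_
  exact (measurable_subtype_coe.comp (measurable_pi_apply e.1)).eq_const e.2

/-- The cylinder probabilities of the forest plus one edge. -/
lemma IsOrientedWSF.rotorLaw_cylinder {r : V} {ν : Measure (Set N.graph.Dart)}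
    (hν : N.IsOrientedWSF r ν) {π : Measure (RotorConfig N.graph)}
    (hπ : π.map RotorConfig.toSubgraph = N.plusEdge r ν) (E : Finset (V × V)) :
    π (rotorCylinder E) = ENNReal.ofReal (N.treeRatio r E *
      (∑ y ∈ N.nbrs r, restrictTo E N.cond r y) / N.totalCond r) := by
  classical
  have := hν.1
  by_cases hE : ∀ e ∈ E, N.graph.Adj e.1 e.2
  · have hinj : Function.Injective fun d : N.graph.Dart => d.toProd :=
      fun _ _ h => SimpleGraph.Dart.ext _ _ h
    let B : Finset N.graph.Dart := E.preimage (fun d => d.toProd) hinj.injOn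
    have hB : ∀ d, d ∈ B ↔ d.toProd ∈ E := fun d => Finset.mem_preimage
    have hpre : rotorCylinder E = RotorConfig.toSubgraph ⁻¹' {F | (B : Set N.graph.Dart) ⊆ F} := by
      ext ρ
      constructor
      · intro h d hd
        exact (h _ ((hB d).1 hd)).symm
      · intro h e he
        exact (h ((hB ⟨e, hE e he⟩).2 he) : e.2 = ρ e.1).symm
    rw [hpre, ← Measure.map_apply measurable_toSubgraph (measurableSet_superset B), hπ,
      N.plusEdge_apply r (measurableSet_superset B)]
    have hterm : ∀ y : N.graph.neighborSet r, ENNReal.ofReal (N.mu r y) *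
        ν {F | insert (⟨(r, y), y.2⟩ : N.graph.Dart) F ∈ {F | (B : Set N.graph.Dart) ⊆ F}} =
        ENNReal.ofReal (N.treeRatio r E * restrictTo E N.cond r y / N.totalCond r) := by
      intro y
      have h1 : {F | insert (⟨(r, y), y.2⟩ : N.graph.Dart) F ∈
          {F | (B : Set N.graph.Dart) ⊆ F}} =
          {F | ((B.erase ⟨(r, y), y.2⟩ : Finset N.graph.Dart) : Set N.graph.Dart) ⊆ F} := by
        ext F
        change (B : Set N.graph.Dart) ⊆ insert _ F ↔ _ ⊆ F
        rw [Finset.coe_erase, Set.sdiff_singleton_subset_iff]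
      rw [h1, hν.apply, wsfProb]
      -- The added edge can supply `(r, y)` only. If `E` demands another edge out of `r`, the forest
      -- would have to contain it, which has probability zero.
      by_cases hc : ∀ b, (r, b) ∈ (E : Set (V × V)) → b = y
      · rw [if_neg, restrictTo, if_pos hc, N.mu_eq]
        · rw [N.treeRatio_congr (E' := E), ← ENNReal.ofReal_mul]
          · congr 1
            ring
          · exact div_nonneg (N.cond_nonneg _ _)
              (Finset.sum_nonneg fun z _ => N.cond_nonneg _ _)
          · intro v hv z
            rw [mem_dartPairs]
            constructor
            · rintro ⟨h, hd⟩
              exact (hB _).1 (Finset.mem_of_mem_erase hd)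
            · intro he
              refine ⟨hE _ he, Finset.mem_erase.2 ⟨fun h => hv ?_, (hB _).2 he⟩⟩
              exact congrArg (fun d : N.graph.Dart => d.fst) h
        · rintro ⟨d, hd, hr⟩
          obtain ⟨hne, hd⟩ := Finset.mem_erase.1 hd
          refine hne (SimpleGraph.Dart.ext _ _ (Prod.ext hr (hc _ ?_)))
          rw [← hr]
          exact (hB d).1 hd
      · rw [if_pos, restrictTo, if_neg hc, mul_zero, mul_zero, zero_div, ENNReal.ofReal_zero]
        push Not at hc
        obtain ⟨b, hb, hne⟩ := hc
        refine ⟨⟨(r, b), hE _ hb⟩, Finset.mem_erase.2 ⟨fun h => hne ?_, (hB _).2 hb⟩, rfl⟩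
        exact congrArg (fun d : N.graph.Dart => d.snd) h
    rw [tsum_congr hterm, N.tsum_neighborSet r fun y =>
      ENNReal.ofReal (N.treeRatio r E * restrictTo E N.cond r y / N.totalCond r),
      ← ENNReal.ofReal_sum_of_nonneg, Finset.mul_sum, Finset.sum_div]
    exact fun y _ => div_nonneg (mul_nonneg (N.treeRatio_nonneg _ _)
      (restrictTo_nonneg N.cond_nonneg _ _)) (Finset.sum_nonneg fun z _ => N.cond_nonneg _ _)
  -- If `E` contains a pair that is not an edge, both sides are zero; which factor vanishes depends
  -- on whether the source is `r`.
  · push Not at hE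
    obtain ⟨⟨x, y⟩, he, hadj⟩ := hE
    have hemp : (rotorCylinder E : Set (RotorConfig N.graph)) = ∅ := by
      rw [Set.eq_empty_iff_forall_notMem]
      intro ρ hρ
      have h1 : (ρ x : V) = y := hρ _ he
      exact hadj (h1 ▸ (ρ x).2)
    rw [hemp, measure_empty]
    by_cases hx : x = r
    · subst hx
      rw [Finset.sum_eq_zero, mul_zero, zero_div, ENNReal.ofReal_zero]
      intro z hz
      rw [restrictTo, if_neg]
      intro h
      have : y = z := h y he
      exact hadj (this ▸ N.mem_nbrs.1 hz)
    · rw [N.treeRatio_eq_zero hx he (Or.inl hadj), zero_mul, zero_div, ENNReal.ofReal_zero]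

end Plus

end ElectricalNetwork

/-! ### Translation invariance and invariance under one step of the scenery. -/

namespace WeightedCayleyGraph

open ElectricalNetwork

variable {Γ : Type u} [Group Γ] (C : WeightedCayleyGraph Γ)

lemma adj_mul_left_iff (g x y : Γ) :
    C.network.graph.Adj (g * x) (g * y) ↔ C.network.graph.Adj x y := by
  refine ⟨fun h => ?_, C.adj_mul_left g⟩
  have := C.adj_mul_left g⁻¹ h
  rwa [inv_mul_cancel_left, inv_mul_cancel_left] at this

lemma cond_mul_left (g x y : Γ) : C.network.cond (g * x) (g * y) = C.network.cond x y := by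
  have h := C.adj_mul_left_iff g x y
  by_cases hxy : C.network.graph.Adj x y
  · rw [cond_of_adj _ hxy, cond_of_adj _ (h.2 hxy)]
    change C.c ((g * y)⁻¹ * (g * x)) = C.c (y⁻¹ * x)
    rw [mul_inv_rev, mul_assoc, inv_mul_cancel_left]
  · rw [cond_of_not_adj _ hxy, cond_of_not_adj _ fun h' => hxy (h.1 h')]

/-- Left translation of a set of pairs. -/
def translate (g : Γ) (E : Finset (Γ × Γ)) : Finset (Γ × Γ) :=
  E.map ((Equiv.mulLeft g).prodCongr (Equiv.mulLeft g)).toEmbedding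

lemma mem_translate {g x y : Γ} {E : Finset (Γ × Γ)} :
    (x, y) ∈ translate g E ↔ (g⁻¹ * x, g⁻¹ * y) ∈ E := by
  rw [translate, Finset.mem_map_equiv]
  rfl

lemma treeRatio_translate (g r : Γ) (E : Finset (Γ × Γ)) :
    C.network.treeRatio (g * r) (translate g E) = C.network.treeRatio r E := by
  refine C.network.treeRatio_map (Equiv.mulLeft g) (fun x y => ?_) (fun x y _ => ?_) r E
  · exact C.adj_mul_left_iff g x y
  · change C.c ((g * y)⁻¹ * (g * x)) = C.c (y⁻¹ * x)
    rw [mul_inv_rev, mul_assoc, inv_mul_cancel_left]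

lemma restrictTo_translate (g x y : Γ) (E : Finset (Γ × Γ)) :
    restrictTo (translate g E) C.network.cond (g * x) (g * y) =
      restrictTo E C.network.cond x y := by
  refine restrictTo_congr (C.cond_mul_left g x y) ?_
  simp only [Finset.mem_coe, mem_translate, inv_mul_cancel_left]
  rw [← (Equiv.mulLeft g).forall_congr_right]
  simp

lemma inv_mem_nbrs {y : Γ} (hy : y ∈ C.network.nbrs 1) : y⁻¹ ∈ C.network.nbrs 1 := by
  rw [mem_nbrs] at hy ⊢
  have := C.adj_mul_left y⁻¹ hy
  rw [inv_mul_cancel, mul_one] at this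
  exact this.symm

/-- Summing over the last step into the identity, seen from there. -/
lemma sum_treeRatio_translate (E : Finset (Γ × Γ)) :
    ∑ y ∈ C.network.nbrs 1, C.network.treeRatio 1 (translate y E) *
      restrictTo (translate y E) C.network.cond 1 y =
    C.network.treeRatio 1 E * ∑ y ∈ C.network.nbrs 1, restrictTo E C.network.cond 1 y := by
  rw [← C.network.sum_treeRatio_mul]
  -- Translating by `y` brings a root at `y⁻¹` to the identity, so the sum is reindexed by
  -- inversion.
  refine Finset.sum_nbij' (fun y => y⁻¹) (fun y => y⁻¹) (fun y hy => C.inv_mem_nbrs hy)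
    (fun y hy => C.inv_mem_nbrs hy) (fun y _ => inv_inv y) (fun y _ => inv_inv y) fun y _ => ?_
  have h1 := C.treeRatio_translate y y⁻¹ E
  have h2 := C.restrictTo_translate y y⁻¹ 1 E
  rw [mul_inv_cancel] at h1 h2
  rw [mul_one] at h2
  rw [h1, h2]

/-- One step of the scenery process: the rotor at the identity is turned to `y`, and the
configuration is viewed from `y`. -/
def step (y : C.network.graph.neighborSet 1) (ρ : RotorConfig C.network.graph) :
    RotorConfig C.network.graph :=
  open Classical in C.viewFrom y (Function.update ρ 1 y)

/-- The rotor at the identity is overwritten by `y`. The event therefore splits into a deterministic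
condition on `y` and a condition on the remaining rotors, that is, on the forest. -/
lemma step_mem_cylinder (y : C.network.graph.neighborSet 1) (ρ : RotorConfig C.network.graph)
    (E : Finset (Γ × Γ)) : C.step y ρ ∈ rotorCylinder E ↔
      (∀ b, (1, b) ∈ (translate y.1 E : Set (Γ × Γ)) → b = y) ∧
        ∀ e ∈ translate y.1 E, e.1 ≠ 1 → (ρ e.1 : Γ) = e.2 := by
  classical
  have h1 : C.step y ρ ∈ rotorCylinder E ↔
      ∀ e ∈ translate y.1 E, (Function.update ρ 1 y e.1 : Γ) = e.2 := by
    rw [translate, Finset.forall_mem_map]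
    refine forall₂_congr fun e _ => ?_
    change (y.1)⁻¹ * (Function.update ρ 1 y (y.1 * e.1) : Γ) = e.2 ↔
      (Function.update ρ 1 y (y.1 * e.1) : Γ) = y.1 * e.2
    rw [inv_mul_eq_iff_eq_mul]
  rw [h1]
  constructor
  · intro h
    refine ⟨fun b hb => ?_, fun e he hne => ?_⟩
    · have := h _ hb
      simp only [Function.update_self] at this
      exact this.symm
    · have := h e he
      rwa [Function.update_of_ne hne] at this
  · rintro ⟨h2, h3⟩ ⟨x, b⟩ he
    by_cases hx : x = 1
    · subst hx
      simp only [Function.update_self]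
      exact (h2 b he).symm
    · simp only [Function.update_of_ne hx]
      exact h3 _ he hx

section Measure

variable [MeasurableSpace Γ]

variable {C}

lemma measurable_viewFrom (g : Γ) [DiscreteMeasurableSpace Γ] : Measurable (C.viewFrom g) := by
  refine measurable_pi_lambda _ fun x => Measurable.subtype_mk ?_
  exact (Measurable.of_discrete (f := fun y : Γ => g⁻¹ * y)).comp
    (measurable_subtype_coe.comp (measurable_pi_apply (g * x)))

lemma measurable_step (y : C.network.graph.neighborSet 1) [DiscreteMeasurableSpace Γ] :
    Measurable (C.step y) := by
  classical
  refine (measurable_viewFrom y.1).comp ?_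
  refine measurable_pi_lambda _ fun x => ?_
  by_cases hx : x = 1
  · subst hx
    simp only [Function.update_self]
    exact measurable_const
  · simp only [Function.update_of_ne hx]
    exact measurable_pi_apply x

lemma measurable_rotor_apply [DiscreteMeasurableSpace Γ] (x : Γ) {β : Type*} [MeasurableSpace β]
    (f : C.network.graph.neighborSet x → β) :
    Measurable fun ρ : RotorConfig C.network.graph => f (ρ x) := by
  have := C.network.countable_vertices
  exact (Measurable.of_discrete (f := f)).comp (measurable_pi_apply x)

/-- A finite law on rotor configurations is determined by the probabilities of cylinders. -/
lemma measure_ext_of_cylinder [DiscreteMeasurableSpace Γ]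
    {μ ν : Measure (RotorConfig C.network.graph)} [IsFiniteMeasure μ]
    (h : ∀ E : Finset (Γ × Γ), μ (rotorCylinder E) = ν (rotorCylinder E)) : μ = ν := by
  classical
  have := C.network.countable_vertices
  have huniv : (rotorCylinder ∅ : Set (RotorConfig C.network.graph)) = Set.univ :=
    Set.eq_univ_of_forall fun ρ e he => absurd he (Finset.notMem_empty e)
  refine ext_of_generate_finite
    (Set.range fun E : Finset (Γ × Γ) => (rotorCylinder E : Set (RotorConfig C.network.graph)))
    ?_ ?_ ?_ ?_
  · refine le_antisymm ?_ (MeasurableSpace.generateFrom_le ?_)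
    · have key : ∀ m : MeasurableSpace (RotorConfig C.network.graph),
          (∀ x (y : C.network.graph.neighborSet x), MeasurableSet[m] {ρ | ρ x = y}) →
          MeasurableSpace.pi ≤ m := by
        intro m hm
        exact iSup_le fun x => Measurable.comap_le
          (@measurable_to_countable' _ _ _ _ m _ fun y => hm x y)
      refine key _ fun x y => MeasurableSpace.measurableSet_generateFrom ⟨{(x, y.1)}, ?_⟩
      ext ρ
      simp [rotorCylinder, Subtype.ext_iff, Set.mem_ofPred_eq]
    · rintro _ ⟨E, rfl⟩
      exact measurableSet_rotorCylinder E
  · rintro _ ⟨E, rfl⟩ _ ⟨E', rfl⟩ -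
    refine ⟨E ∪ E', ?_⟩
    ext ρ
    simp only [rotorCylinder, Set.mem_inter_iff, Set.mem_ofPred_eq, Finset.mem_union, or_imp,
      forall_and]
  · rintro _ ⟨E, rfl⟩
    exact h E
  · rw [← huniv]
    exact h ∅

variable [DiscreteMeasurableSpace Γ] {ν : Measure (Set C.network.graph.Dart)}
  {π : Measure (RotorConfig C.network.graph)}

lemma IsPlusLaw.isFiniteMeasure (hν : C.network.IsOrientedWSF 1 ν) (hπ : C.IsPlusLaw 1 ν π) :
    IsFiniteMeasure π := by
  refine ⟨?_⟩
  have huniv : (rotorCylinder ∅ : Set (RotorConfig C.network.graph)) = Set.univ :=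
    Set.eq_univ_of_forall fun ρ e he => absurd he (Finset.notMem_empty e)
  rw [← huniv, hν.rotorLaw_cylinder hπ]
  exact ENNReal.ofReal_lt_top

/-- Independence of the added edge and the forest, at the level of cylinders. -/
lemma IsPlusLaw.apply_rotor_inter (hν : C.network.IsOrientedWSF 1 ν) (hπ : C.IsPlusLaw 1 ν π)
    (E : Finset (Γ × Γ)) (y : C.network.graph.neighborSet 1) :
    π {ρ | ρ 1 = y ∧ ∀ e ∈ E, e.1 ≠ 1 → (ρ e.1 : Γ) = e.2} =
      ENNReal.ofReal (C.network.treeRatio 1 E) * ENNReal.ofReal (C.network.mu 1 y) := by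
  classical
  set F : Finset (Γ × Γ) := insert (1, y.1) (E.filter fun e => e.1 ≠ 1) with hF
  have h1 : {ρ : RotorConfig C.network.graph | ρ 1 = y ∧
      ∀ e ∈ E, e.1 ≠ 1 → (ρ e.1 : Γ) = e.2} = rotorCylinder F := by
    ext ρ
    simp only [rotorCylinder, hF, Finset.forall_mem_insert, Finset.mem_filter, and_imp,
      Subtype.ext_iff, Set.mem_ofPred_eq]
  have h2 : C.network.treeRatio 1 F = C.network.treeRatio 1 E := by
    refine C.network.treeRatio_congr fun v hv z => ?_
    simp [hF, hv]
  have h3 : ∑ z ∈ C.network.nbrs 1, restrictTo F C.network.cond 1 z = C.network.cond 1 y := by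
    rw [Finset.sum_eq_single y.1]
    · rw [restrictTo, if_pos]
      intro b hb
      simpa [hF] using hb
    · intro z _ hz
      rw [restrictTo, if_neg]
      exact fun h => hz (h y (by simp [hF])).symm
    · exact fun h => absurd (C.network.mem_nbrs.2 y.2) h
  rw [h1, hν.rotorLaw_cylinder hπ, h2, h3, C.network.mu_eq, mul_div_assoc,
    ENNReal.ofReal_mul (C.network.treeRatio_nonneg _ _)]

/-- The forest plus one edge is invariant under one step of the scenery process. -/
theorem IsPlusLaw.sum_map_step (hν : C.network.IsOrientedWSF 1 ν) (hπ : C.IsPlusLaw 1 ν π)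
    {p : Mechanism C.network.graph} (hp : C.IsTransitive p) :
    Measure.sum (fun z : C.network.graph.neighborSet 1 =>
      (π.withDensity fun ρ => p 1 (ρ 1) z).map (C.step z)) = π := by
  classical
  have := C.network.countable_vertices
  have := hπ.isFiniteMeasure hν
  symm
  refine measure_ext_of_cylinder fun E => ?_
  rw [Measure.sum_apply _ (measurableSet_rotorCylinder E), hν.rotorLaw_cylinder hπ]
  have hterm : ∀ z : C.network.graph.neighborSet 1,
      (π.withDensity fun ρ => p 1 (ρ 1) z).map (C.step z) (rotorCylinder E) =
        ENNReal.ofReal (C.network.treeRatio 1 (translate z E) *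
          restrictTo (translate z.1 E) C.network.cond 1 z / C.network.totalCond 1) := by
    intro z
    rw [Measure.map_apply (measurable_step z) (measurableSet_rotorCylinder E),
      withDensity_apply _ (measurable_step z (measurableSet_rotorCylinder E))]
    by_cases hc : ∀ b, (1, b) ∈ (translate z.1 E : Set (Γ × Γ)) → b = z
    -- Decomposition according to the old rotor `y`, on which the transition probability depends.
    · have hpre : C.step z ⁻¹' rotorCylinder E = ⋃ y : C.network.graph.neighborSet 1,
          {ρ | ρ 1 = y ∧ ∀ e ∈ translate z.1 E, e.1 ≠ 1 → (ρ e.1 : Γ) = e.2} := by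
        ext ρ
        simp only [Set.mem_preimage, step_mem_cylinder, Set.mem_iUnion]
        constructor
        · exact fun h => ⟨ρ 1, rfl, h.2⟩
        · rintro ⟨y, -, h⟩
          exact ⟨hc, h⟩
      have hmeas : ∀ y : C.network.graph.neighborSet 1, MeasurableSet
          {ρ : RotorConfig C.network.graph | ρ 1 = y ∧
            ∀ e ∈ translate z.1 E, e.1 ≠ 1 → (ρ e.1 : Γ) = e.2} := by
        intro y
        refine measurableSet_setOfPred.2 (Measurable.and ?_ ?_)
        · exact measurable_rotor_apply 1 fun w => w = y
        · refine Measurable.forall fun e => Measurable.imp measurable_const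
            (Measurable.imp measurable_const ?_)
          exact measurable_rotor_apply e.1 fun w => (w : Γ) = e.2
      rw [hpre, lintegral_iUnion hmeas]
      · have hint : ∀ y : C.network.graph.neighborSet 1,
            ∫⁻ ρ in {ρ | ρ 1 = y ∧ ∀ e ∈ translate z.1 E, e.1 ≠ 1 → (ρ e.1 : Γ) = e.2},
              p 1 (ρ 1) z ∂π = ENNReal.ofReal (C.network.treeRatio 1 (translate z E)) *
                (ENNReal.ofReal (C.network.mu 1 y) * p 1 y z) := by
          intro y
          rw [setLIntegral_congr_fun (g := fun _ => p 1 y z) (hmeas y)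
            (fun ρ hρ => by rw [hρ.1]), setLIntegral_const, hπ.apply_rotor_inter hν,
            mul_comm, mul_assoc]
        -- Stationarity of `μ_1` for the mechanism sums out the old rotor: the new rotor is `z` with
        -- probability `μ_1 z`, independently of the forest.
        rw [tsum_congr hint, ENNReal.tsum_mul_left, hp.1 1 z, restrictTo, if_pos hc,
          C.network.mu_eq, mul_div_assoc, ENNReal.ofReal_mul (C.network.treeRatio_nonneg _ _)]
      · intro y y' hne
        refine Set.disjoint_left.2 fun ρ h h' => hne (h.1.symm.trans h'.1)
    · have hpre : C.step z ⁻¹' rotorCylinder E = ∅ := by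
        rw [Set.eq_empty_iff_forall_notMem]
        intro ρ h
        exact hc ((C.step_mem_cylinder z ρ E).1 h).1
      rw [hpre, setLIntegral_empty, restrictTo, if_neg hc, mul_zero, zero_div,
        ENNReal.ofReal_zero]
  rw [tsum_congr hterm, C.network.tsum_neighborSet 1 fun z =>
    ENNReal.ofReal (C.network.treeRatio 1 (translate z E) *
          restrictTo (translate z E) C.network.cond 1 z / C.network.totalCond 1),
    ← C.sum_treeRatio_translate, Finset.sum_div, ENNReal.ofReal_sum_of_nonneg]
  exact fun z _ => div_nonneg (mul_nonneg (C.network.treeRatio_nonneg _ _)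
    (restrictTo_nonneg C.network.cond_nonneg _ _))
    (Finset.sum_nonneg fun _ _ => C.network.cond_nonneg _ _)

/-- The transition operator of the scenery process. -/
def sceneryKernel (p : Mechanism C.network.graph) (f : RotorConfig C.network.graph → ENNReal)
    (ρ : RotorConfig C.network.graph) : ENNReal :=
  ∑' z : C.network.graph.neighborSet 1, p 1 (ρ 1) z * f (C.step z ρ)

lemma measurable_sceneryKernel (p : Mechanism C.network.graph)
    {f : RotorConfig C.network.graph → ENNReal} (hf : Measurable f) :
    Measurable (sceneryKernel p f) := by
  have := C.network.countable_vertices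
  refine Measurable.tsum fun z => ?_
  exact (measurable_rotor_apply 1 fun w => p 1 w z).mul (hf.comp (measurable_step z))

lemma IsPlusLaw.lintegral_sceneryKernel (hν : C.network.IsOrientedWSF 1 ν)
    (hπ : C.IsPlusLaw 1 ν π) {p : Mechanism C.network.graph} (hp : C.IsTransitive p)
    {f : RotorConfig C.network.graph → ENNReal} (hf : Measurable f) :
    ∫⁻ ρ, sceneryKernel p f ρ ∂π = ∫⁻ ρ, f ρ ∂π := by
  have := C.network.countable_vertices
  have hmeas : ∀ z : C.network.graph.neighborSet 1,
      Measurable fun ρ : RotorConfig C.network.graph => p 1 (ρ 1) z := fun z =>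
    measurable_rotor_apply 1 fun w => p 1 w z
  conv_rhs => rw [← hπ.sum_map_step hν hp]
  rw [lintegral_sum_measure]
  simp only [sceneryKernel]
  refine (lintegral_tsum fun z =>
    ((hmeas z).mul (hf.comp (measurable_step z))).aemeasurable).trans ?_
  refine tsum_congr fun z => ?_
  rw [lintegral_map hf (measurable_step z)]
  exact (lintegral_withDensity_eq_lintegral_mul _ (hmeas z) (hf.comp (measurable_step z))).symm

end Measure

end WeightedCayleyGraph

/-! ### The scenery process is Markov, hence stationary. -/

lemma IsRWLM.walkPast_le {V : Type u} [MeasurableSpace V] {G : SimpleGraph V}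
    {p : Mechanism G} {Ω : Type w} [MeasurableSpace Ω] {P : Measure Ω} {X : ℕ → Ω → V}
    {ρ : ℕ → Ω → RotorConfig G} (h : IsRWLM p P X ρ) (n : ℕ) :
    walkPast X ρ n ≤ ‹MeasurableSpace Ω› :=
  iSup₂_le fun k _ => ((h.measurable_location k).prodMk (h.measurable_rotor k)).comap_le

/-- The transition rule of a random walk with local memory, for functions of the past. -/
lemma IsRWLM.setLIntegral_transition {V : Type u} [MeasurableSpace V] {G : SimpleGraph V}
    {p : Mechanism G} {Ω : Type w} [MeasurableSpace Ω] {P : Measure Ω}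
    {X : ℕ → Ω → V} {ρ : ℕ → Ω → RotorConfig G} (h : IsRWLM p P X ρ) (n : ℕ) {A : Set Ω}
    (hA : MeasurableSet[walkPast X ρ n] A) {x : V} (y y' : G.neighborSet x) {f : Ω → ENNReal}
    (hf : Measurable[walkPast X ρ n] f) :
    ∫⁻ ω in A ∩ {ω | X n ω = x ∧ ρ n ω x = y} ∩ {ω | X (n + 1) ω = y'}, f ω ∂P =
      p x y y' * ∫⁻ ω in A ∩ {ω | X n ω = x ∧ ρ n ω x = y}, f ω ∂P := by
  have hle := h.walkPast_le n
  rw [← smul_eq_mul, ← lintegral_smul_measure, ← lintegral_trim hle hf, ← lintegral_trim hle hf]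
  congr 1
  -- Restricted to the past, the two weighted measures agree on every event by the transition rule,
  -- hence they integrate functions of the past equally.
  refine @Measure.ext _ (walkPast X ρ n) _ _ fun B hB => ?_
  rw [trim_measurableSet_eq hle hB, trim_measurableSet_eq hle hB, Measure.smul_apply,
    Measure.restrict_apply (hle _ hB), Measure.restrict_apply (hle _ hB), smul_eq_mul,
    ← Set.inter_assoc, ← Set.inter_assoc,
    h.transition n (B ∩ A) (@MeasurableSet.inter _ (walkPast X ρ n) _ _ hB hA), mul_comm]

namespace WeightedCayleyGraph

open ElectricalNetwork

variable {Γ : Type u} [Group Γ] {C : WeightedCayleyGraph Γ}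

lemma coe_update [DecidableEq Γ] (σ : RotorConfig C.network.graph) {a : Γ}
    (b : C.network.graph.neighborSet a) (v : Γ) :
    (Function.update σ a b v : Γ) = if v = a then (b : Γ) else (σ v : Γ) := by
  by_cases h : v = a
  · subst h
    simp
  · simp [h]

/-- Left translation by `x` takes the identity to the walker. The new scenery thus depends only on
the old one and the relative step `z`, not on the position. -/
lemma step_viewFrom {x : Γ} {σ σ' : RotorConfig C.network.graph}
    {z : C.network.graph.neighborSet 1} (h1 : (σ' x : Γ) = x * z)
    (h2 : ∀ v, v ≠ x → σ' v = σ v) :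
    C.step z (C.viewFrom x σ) = C.viewFrom (x * z) σ' := by
  classical
  funext v
  refine Subtype.ext ?_
  change (z.1)⁻¹ * (Function.update (C.viewFrom x σ) 1 z (z.1 * v) : Γ) =
    (x * z.1)⁻¹ * (σ' (x * z.1 * v) : Γ)
  rw [coe_update]
  split_ifs with hv
  · have : x * z.1 * v = x := by rw [mul_assoc, hv, mul_one]
    rw [this, h1]
    group
  · have : x * z.1 * v ≠ x := by
      rw [mul_assoc]
      exact fun h => hv (mul_eq_left.1 h)
    rw [h2 _ this, mul_assoc x]
    change (z.1)⁻¹ * (x⁻¹ * (σ (x * (z.1 * v)) : Γ)) = _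
    group

/-- Left multiplication by `x`, from the neighbors of the identity to those of `x`. -/
def nbrOf (x : Γ) (z : C.network.graph.neighborSet 1) : C.network.graph.neighborSet x :=
  ⟨x * z, by
    have h := C.adj_mul_left x z.2
    rwa [mul_one] at h⟩

lemma IsTransitive.apply_nbrOf {p : Mechanism C.network.graph} (hp : C.IsTransitive p) (x : Γ)
    (w z : C.network.graph.neighborSet 1) : p x (nbrOf x w) (nbrOf x z) = p 1 w z := by
  rw [hp.2 1 x w z]
  -- Invariance yields neighbors of `x * 1`, a different type from the neighbors of `x`; the vertex
  -- is generalized so that the equality can be substituted.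
  have key : ∀ a (_ : x = a) (w' z' : C.network.graph.neighborSet a), w'.1 = x * w →
      z'.1 = x * z → p x (nbrOf x w) (nbrOf x z) = p a w' z' := by
    rintro _ rfl w' z' h1 h2
    rw [(Subtype.ext h1 : w' = nbrOf x w), (Subtype.ext h2 : z' = nbrOf x z)]
  exact key _ (mul_one x).symm _ _ rfl rfl

/-- The neighbor of the identity that `y`, a neighbor of `x`, is seen as from `x`. -/
lemma exists_nbrOf_eq {x : Γ} (y : C.network.graph.neighborSet x) : ∃ w, nbrOf x w = y := by
  refine ⟨⟨x⁻¹ * y, ?_⟩, Subtype.ext (mul_inv_cancel_left x y)⟩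
  have h := C.adj_mul_left x⁻¹ y.2
  rwa [inv_mul_cancel] at h

lemma nbrOf_injective (x : Γ) : Function.Injective (nbrOf (C := C) x) := fun _ _ h =>
  Subtype.ext (mul_left_cancel (congrArg Subtype.val h))

variable [MeasurableSpace Γ] [DiscreteMeasurableSpace Γ] {p : Mechanism C.network.graph}
  {Ω : Type w} [MeasurableSpace Ω] {P : Measure Ω}
  {X : ℕ → Ω → Γ} {ρ : ℕ → Ω → RotorConfig C.network.graph}

/-- The scenery process. -/
def scenery (C : WeightedCayleyGraph Γ) (X : ℕ → Ω → Γ) (ρ : ℕ → Ω → RotorConfig C.network.graph)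
    (n : ℕ) (ω : Ω) : RotorConfig C.network.graph := C.viewFrom (X n ω) (ρ n ω)

omit [MeasurableSpace Ω] in
lemma measurable_scenery_past (n : ℕ) : Measurable[walkPast X ρ n] (C.scenery X ρ n) := by
  have := C.network.countable_vertices
  have h1 : Measurable fun q : Γ × RotorConfig C.network.graph => C.viewFrom q.1 q.2 :=
    measurable_from_prod_countable_right fun g => measurable_viewFrom g
  have h2 : Measurable[MeasurableSpace.comap (fun ω => (X n ω, ρ n ω)) inferInstance]
      (C.scenery X ρ n) := h1.comp (comap_measurable fun ω => (X n ω, ρ n ω))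
  exact h2.mono (le_iSup₂_of_le n le_rfl le_rfl) le_rfl

lemma measurable_scenery (h : IsRWLM p P X ρ) (n : ℕ) : Measurable (C.scenery X ρ n) :=
  (measurable_scenery_past n).mono (h.walkPast_le n) le_rfl

/-- The Markov property of the scenery process. -/
lemma setLIntegral_scenery_succ (hp : C.IsTransitive p) (h : IsRWLM p P X ρ) (n : ℕ)
    {A : Set Ω} (hA : MeasurableSet[walkPast X ρ n] A)
    {g : RotorConfig C.network.graph → ENNReal} (hg : Measurable g) :
    ∫⁻ ω in A, g (C.scenery X ρ (n + 1) ω) ∂P =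
      ∫⁻ ω in A, sceneryKernel p g (C.scenery X ρ n ω) ∂P := by
  have := C.network.countable_vertices
  have hA' : MeasurableSet A := h.walkPast_le n _ hA
  have hstep : ∀ z, Measurable[walkPast X ρ n] fun ω => g (C.step z (C.scenery X ρ n ω)) :=
    fun z => (hg.comp (measurable_step z)).comp (measurable_scenery_past n)
  -- Partition by the location and the relative rotor there, then by the relative next step. On each
  -- piece the transition probability is constant.
  let B : Γ × C.network.graph.neighborSet 1 → Set Ω := fun i =>
    {ω | X n ω = i.1 ∧ ρ n ω i.1 = nbrOf i.1 i.2}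
  let E : (Γ × C.network.graph.neighborSet 1) × C.network.graph.neighborSet 1 → Set Ω :=
    fun i => {ω | X (n + 1) ω = nbrOf i.1.1 i.2}
  have hB : ∀ i, MeasurableSet (B i) := fun i => measurableSet_setOfPred.2
    (Measurable.and ((h.measurable_location n).eq_const i.1)
      ((measurable_rotor_apply i.1 fun w => w = nbrOf i.1 i.2).comp (h.measurable_rotor n)))
  have hE : ∀ i, MeasurableSet (E i) := fun i => measurableSet_setOfPred.2
    ((h.measurable_location (n + 1)).eq_const _)
  have hBdisj : Pairwise (Function.onFun Disjoint B) := by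
    intro i j hij
    refine Set.disjoint_left.2 fun ω hi hj => hij ?_
    obtain ⟨x, w⟩ := i
    obtain ⟨x', w'⟩ := j
    have hx : x = x' := hi.1.symm.trans hj.1
    subst hx
    exact congrArg (Prod.mk x) (nbrOf_injective x (hi.2.symm.trans hj.2))
  have hBuniv : ∀ ω, ∃ i, ω ∈ B i := by
    intro ω
    obtain ⟨w, hw⟩ := exists_nbrOf_eq (ρ n ω (X n ω))
    exact ⟨(X n ω, w), rfl, hw.symm⟩
  have hview : ∀ i, ∀ ω ∈ B i, C.scenery X ρ n ω 1 = i.2 := by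
    intro i ω hω
    refine Subtype.ext ?_
    change (X n ω)⁻¹ * (ρ n ω (X n ω * 1) : Γ) = i.2
    rw [mul_one, hω.1, hω.2]
    exact inv_mul_cancel_left _ _
  have hL : ∫⁻ ω in A, g (C.scenery X ρ (n + 1) ω) ∂P = ∑' i, ∑' z : C.network.graph.neighborSet 1,
      p 1 i.2 z * ∫⁻ ω in A ∩ B i, g (C.step z (C.scenery X ρ n ω)) ∂P := by
    -- The pieces cover `A` only up to a null set: the next location is almost surely the new rotor,
    -- hence a neighbor.
    have hU : A =ᵐ[P] ⋃ i, A ∩ B i.1 ∩ E i := by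
      refine Filter.eventuallyEq_set.2 ?_
      filter_upwards [h.rotor_update n] with ω hω
      constructor
      · intro hωA
        obtain ⟨i, hi⟩ := hBuniv ω
        obtain ⟨z, hz⟩ := exists_nbrOf_eq (ρ (n + 1) ω (X n ω))
        refine Set.mem_iUnion.2 ⟨(i, z), ⟨hωA, hi⟩, ?_⟩
        change X (n + 1) ω = nbrOf i.1 z
        rw [← hω.1, ← hz, hi.1]
      · intro hω
        obtain ⟨i, hi⟩ := Set.mem_iUnion.1 hω
        exact hi.1.1
    rw [setLIntegral_congr hU, lintegral_iUnion (fun i => (hA'.inter (hB i.1)).inter (hE i)),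
      ENNReal.tsum_prod']
    · refine tsum_congr fun i => tsum_congr fun z => ?_
      rw [← hp.apply_nbrOf i.1, ← h.setLIntegral_transition n hA _ _ (hstep z)]
      refine setLIntegral_congr_fun_ae ((hA'.inter (hB i)).inter (hE (i, z))) ?_
      filter_upwards [h.rotor_update n] with ω hω hωD
      congr 1
      have hX : X n ω = i.1 := hωD.1.2.1
      have hX' : X (n + 1) ω = i.1 * z := hωD.2
      rw [scenery, scenery, hX, hX']
      rw [hX, hX'] at hω
      exact (step_viewFrom hω.1 hω.2).symm
    · rintro ⟨i, z⟩ ⟨j, z'⟩ hij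
      refine Set.disjoint_left.2 fun ω hi hj => hij ?_
      have hij' : i = j := by
        by_contra hne
        exact Set.disjoint_left.1 (hBdisj hne) hi.1.2 hj.1.2
      subst hij'
      have : nbrOf i.1 z = nbrOf i.1 z' := Subtype.ext (hi.2.symm.trans hj.2)
      rw [nbrOf_injective _ this]
  have hR : ∫⁻ ω in A, sceneryKernel p g (C.scenery X ρ n ω) ∂P =
      ∑' i, ∑' z : C.network.graph.neighborSet 1,
      p 1 i.2 z * ∫⁻ ω in A ∩ B i, g (C.step z (C.scenery X ρ n ω)) ∂P := by
    have hU : A = ⋃ i, A ∩ B i := by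
      rw [← Set.inter_iUnion, Set.iUnion_eq_univ_iff.2 hBuniv, Set.inter_univ]
    conv_lhs => rw [hU]
    rw [lintegral_iUnion (fun i => hA'.inter (hB i))]
    · refine tsum_congr fun i => ?_
      have hcongr : ∫⁻ ω in A ∩ B i, sceneryKernel p g (C.scenery X ρ n ω) ∂P =
          ∫⁻ ω in A ∩ B i, ∑' z : C.network.graph.neighborSet 1,
            p 1 i.2 z * g (C.step z (C.scenery X ρ n ω)) ∂P := by
        refine setLIntegral_congr_fun (hA'.inter (hB i)) fun ω hω => ?_
        rw [sceneryKernel, hview i ω hω.2]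
      have hm : ∀ z, Measurable fun ω => g (C.step z (C.scenery X ρ n ω)) := fun z =>
        (hstep z).mono (h.walkPast_le n) le_rfl
      rw [hcongr, lintegral_tsum fun z => ((hm z).const_mul _).aemeasurable]
      exact tsum_congr fun z => lintegral_const_mul _ (hm z)
    · exact fun i j hij => (hBdisj hij).mono Set.inter_subset_right Set.inter_subset_right
  rw [hL, hR]

/-- The probability that a scenery process started at `σ` is in `S i` at the times `i ≤ k`. -/
def sceneryProb (p : Mechanism C.network.graph) :
    ℕ → (ℕ → Set (RotorConfig C.network.graph)) → RotorConfig C.network.graph → ENNReal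
  | 0, S => (S 0).indicator 1
  | k + 1, S => (S 0).indicator (sceneryKernel p (sceneryProb p k fun i => S (i + 1)))

lemma measurable_sceneryProb (k : ℕ) : ∀ {S : ℕ → Set (RotorConfig C.network.graph)},
    (∀ i, MeasurableSet (S i)) → Measurable (sceneryProb p k S) := by
  induction k with
  | zero => exact fun hS => measurable_one.indicator (hS 0)
  | succ k ih =>
    exact fun hS => (measurable_sceneryKernel p (ih fun i => hS (i + 1))).indicator (hS 0)

/-- Induction on `k` with the time `n` and the past event `A` free: the first condition is absorbed
into `A`, and the Markov property moves the remaining ones one step back. -/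
lemma measure_inter_scenery (hp : C.IsTransitive p) (h : IsRWLM p P X ρ) (k : ℕ) :
    ∀ (n : ℕ) {S : ℕ → Set (RotorConfig C.network.graph)} (_ : ∀ i, MeasurableSet (S i))
      {A : Set Ω} (_ : MeasurableSet[walkPast X ρ n] A),
      P (A ∩ {ω | ∀ i ≤ k, C.scenery X ρ (n + i) ω ∈ S i}) =
        ∫⁻ ω in A, sceneryProb p k S (C.scenery X ρ n ω) ∂P := by
  induction k with
  | zero =>
    intro n S hS A hA
    have hA' := h.walkPast_le n _ hA
    have hpre : MeasurableSet (C.scenery X ρ n ⁻¹' S 0) := measurable_scenery h n (hS 0)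
    have h1 : (fun ω => sceneryProb p 0 S (C.scenery X ρ n ω)) =
        (C.scenery X ρ n ⁻¹' S 0).indicator 1 := rfl
    rw [h1, lintegral_indicator_one hpre, Measure.restrict_apply hpre, Set.inter_comm]
    congr 2
    ext ω
    simp
  | succ k ih =>
    intro n S hS A hA
    have hA' := h.walkPast_le n _ hA
    have hpre' : MeasurableSet[walkPast X ρ n] (C.scenery X ρ n ⁻¹' S 0) :=
      measurable_scenery_past n (hS 0)
    have hpre : MeasurableSet (C.scenery X ρ n ⁻¹' S 0) := measurable_scenery h n (hS 0)
    have hA1 : MeasurableSet[walkPast X ρ n] (A ∩ C.scenery X ρ n ⁻¹' S 0) :=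
      @MeasurableSet.inter _ (walkPast X ρ n) _ _ hA hpre'
    have hle : walkPast X ρ n ≤ walkPast X ρ (n + 1) :=
      biSup_mono fun k hk => hk.trans n.le_succ
    have h2 := ih (n + 1) (fun i => hS (i + 1)) (hle _ hA1)
    rw [setLIntegral_scenery_succ hp h n hA1 (measurable_sceneryProb k fun i => hS (i + 1))] at h2
    have h1 : (fun ω => sceneryProb p (k + 1) S (C.scenery X ρ n ω)) =
        (C.scenery X ρ n ⁻¹' S 0).indicator fun ω =>
          sceneryKernel p (sceneryProb p k fun i => S (i + 1)) (C.scenery X ρ n ω) := rfl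
    rw [h1, setLIntegral_indicator hpre, Set.inter_comm _ A, ← h2, Set.inter_assoc]
    congr 2
    ext ω
    constructor
    · intro hω
      refine ⟨hω 0 (Nat.zero_le _), fun i hi => ?_⟩
      have := hω (i + 1) (Nat.succ_le_succ hi)
      rwa [← add_assoc, add_right_comm] at this
    · rintro ⟨h0, hω⟩ i hi
      cases i with
      | zero => exact h0
      | succ i =>
        have := hω i (Nat.le_of_succ_le_succ hi)
        rwa [add_right_comm, add_assoc] at this

/-- The forest plus one edge is a native environment. -/
theorem IsPlusLaw.isNativeEnvironment {ν : Measure (Set C.network.graph.Dart)}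
    {π : Measure (RotorConfig C.network.graph)} (hν : C.network.IsOrientedWSF 1 ν)
    (hπ : C.IsPlusLaw 1 ν π) (hp : C.IsTransitive p) :
    WeightedCayleyGraph.IsNativeEnvironment.{u, w} C p π := by
  intro Ω _ P _ X ρ h hX0 hρ0
  have hmeas := measurable_scenery h
  have hlaw : P.map (C.scenery X ρ 0) = π := by
    rw [← hρ0]
    refine Measure.map_congr ?_
    filter_upwards [hX0] with ω hω
    rw [scenery, hω]
    funext v
    refine Subtype.ext ?_
    change (1 : Γ)⁻¹ * (ρ 0 ω (1 * v) : Γ) = ρ 0 ω v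
    rw [inv_one, one_mul, one_mul]
  have hproc : Measurable fun ω (n : ℕ) => C.scenery X ρ n ω :=
    measurable_pi_lambda _ fun n => hmeas n
  have hproc' : Measurable fun ω (n : ℕ) => C.scenery X ρ (n + 1) ω :=
    measurable_pi_lambda _ fun n => hmeas (n + 1)
  refine ⟨hproc.aemeasurable, hproc'.aemeasurable, ?_⟩
  change P.map (fun ω (n : ℕ) => C.scenery X ρ n ω) =
    P.map (fun ω (n : ℕ) => C.scenery X ρ (n + 1) ω)
  have := Measure.isProbabilityMeasure_map (μ := P) hproc.aemeasurable
  have := Measure.isProbabilityMeasure_map (μ := P) hproc'.aemeasurable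
  refine ext_of_generate_finite _ generateFrom_squareCylinders.symm
    (isPiSystem_squareCylinders (fun _ => MeasurableSpace.isPiSystem_measurableSet)
      (fun _ => by simp)) ?_ (by simp)
  classical
  rintro _ ⟨s, t, ht, rfl⟩
  have ht : ∀ i, MeasurableSet (t i) := fun i => ht i (Set.mem_univ i)
  -- The times outside `s` up to `k` are given the trivial condition, so that finite-dimensional
  -- events fit the recursion over consecutive times.
  obtain ⟨k, hk⟩ : ∃ k, ∀ i ∈ s, i ≤ k := ⟨s.sup id, fun i hi => Finset.le_sup (f := id) hi⟩
  let S : ℕ → Set (RotorConfig C.network.graph) := fun i => if i ∈ s then t i else Set.univ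
  have hS : ∀ i, MeasurableSet (S i) := by
    intro i
    change MeasurableSet (if i ∈ s then t i else Set.univ)
    split_ifs
    · exact ht i
    · exact MeasurableSet.univ
  have hval : ∀ n, P {ω | ∀ i ∈ s, C.scenery X ρ (n + i) ω ∈ t i} =
      ∫⁻ ω, sceneryProb p k S (C.scenery X ρ n ω) ∂P := by
    intro n
    have h1 := measure_inter_scenery hp h k n hS (A := Set.univ)
      (@MeasurableSet.univ _ (walkPast X ρ n))
    rw [Set.univ_inter, Measure.restrict_univ] at h1
    rw [← h1]
    congr 1
    ext ω
    constructor
    · intro hω i _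
      change _ ∈ if i ∈ s then t i else Set.univ
      split_ifs with hi
      · exact hω i hi
      · exact Set.mem_univ _
    · intro hω i hi
      have h2 : _ ∈ if i ∈ s then t i else Set.univ := hω i (hk i hi)
      rwa [if_pos hi] at h2
  have hms : MeasurableSet ((s : Set ℕ).pi t) :=
    MeasurableSet.pi s.countable_toSet fun i _ => ht i
  have hprob := measurable_sceneryProb (p := p) k hS
  have h0 := hval 0
  have h1 := hval 1
  -- The expectation at time `1` is the transition operator integrated against the law at time `0`.
  -- That law is `π`, which is invariant, so the two times agree.
  have hs := setLIntegral_scenery_succ hp h 0 (@MeasurableSet.univ _ (walkPast X ρ 0)) hprob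
  rw [Measure.restrict_univ, zero_add,
    ← lintegral_map (measurable_sceneryKernel p hprob) (hmeas 0), hlaw,
    hπ.lintegral_sceneryKernel hν hp hprob, ← hlaw, lintegral_map hprob (hmeas 0), ← h0,
    ← h1] at hs
  rw [Measure.map_apply hproc hms, Measure.map_apply hproc' hms]
  simp only [zero_add, add_comm 1] at hs
  exact hs.symm

end WeightedCayleyGraph

end

theorem mainTheorem2 {Γ : Type u} [Group Γ] [MeasurableSpace Γ] [DiscreteMeasurableSpace Γ]
    (C : WeightedCayleyGraph Γ) (hS : C.S.Nonempty) :
    (∃! ν : Measure (Set C.network.graph.Dart), C.network.IsOrientedWSF 1 ν) ∧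
    ∀ ν : Measure (Set C.network.graph.Dart), C.network.IsOrientedWSF 1 ν →
      (∃! π : Measure (RotorConfig C.network.graph), C.IsPlusLaw 1 ν π) ∧
      ∀ π : Measure (RotorConfig C.network.graph), C.IsPlusLaw 1 ν π →
        ∀ p : Mechanism C.network.graph, C.IsTransitive p →
          WeightedCayleyGraph.IsNativeEnvironment.{u, w} C p π := by
  obtain ⟨s, hs⟩ := hS
  -- A generator gives every vertex a default neighbor, hence a rotor configuration to use on the
  -- exceptional null set.
  have hadj : ∀ x : Γ, C.network.graph.Adj x (x * s⁻¹) := fun x => C.adj_iff.2 (by simpa using hs)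
  exact ⟨C.network.existsUnique_isOrientedWSF 1, fun ν hν =>
    ⟨hν.existsUnique_rotorLaw fun x => ⟨x * s⁻¹, hadj x⟩,
      fun π hπ p hp => hπ.isNativeEnvironment hν hp⟩⟩
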